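/- Let $n\ge 1$ and let $\Omega\subset\mathbb R^n$ be a bounded open set. Let $A=-\Delta$ be the Dirichlet Laplacian in $L^2(\Omega)$ (complex valued), with $D(A)=\{u\in H^1_0(\Omega):\Delta u\in L^2(\Omega)\}$; if $\partial\Omega$ is smooth this is $H^2(\Omega)\cap H^1_0(\Omega)$. Let $\alpha,\kappa,\delta>0$ and $\gamma\in\mathbb R\setminus\{0\}$. For $\theta=\tfrac12$ and $\beta=1$ consider the system $$u_{tt}+\kappa A^{\beta}u_{tt}+\alpha A^2u+\gamma Av_t=0,\qquad v_{tt}+\alpha Av-\gamma Au_t+\delta A^{\theta}v_t=0 ,$$ written as $\frac{d}{dt}U=\mathbb B U$, $U=(u,v,w,z)=(u,v,u_t,v_t)$, in the phase space $\mathcal H=D(A)\times D(A^{1/2})\times D(A^{1/2})\times L^2(\Omega)$ with norm $$\|U\|_{\mathcal H}^2=\alpha\|Au\|^2+\alpha\|A^{1/2}v\|^2+\|w\|^2+\kappa\|A^{1/2}w\|^2+\|z\|^2 ,$$ where $$\mathbb BU=\big(w,\ z,\ -(I+\kappa A)^{-1}(\alpha A^2u+\gamma Az),\ -\alpha Av+\gamma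 Aw-\delta A^{1/2}z\big),$$ with domain the set of all $U\in\mathcal H$ such that $w\in D(A)$, $z\in D(A^{1/2})$, $\alpha A^2u+\gamma Az\in D(A^{-1/2})$ (the dual of $D(A^{1/2})$; $I+\kappa A$ is the isomorphism $D(A^{1/2})\to D(A^{-1/2})$) and $\alpha v+\delta A^{-1/2}z\in D(A)$; the last component of $\mathbb BU$ is understood as $-A(\alpha v+\delta A^{-1/2}z)+\gamma Aw$. Then $i\mathbb R\subset\rho(\mathbb B)$, and there is a constant $C>0$ such that, for all $\lambda\in\mathbb R$, all $F\in\mathcal H$ and all $U\in D(\mathbb B)$ with $(i\lambda I-\mathbb B)U=F$, $$|\lambda|\,\|U\|_{\mathcal H}^2\le C\,\|F\|_{\mathcal H}\|U\|_{\mathcal H}.$$ Moreover $\mathbb B$ is the infinitesimal generator of a $C_0$-semigroup $S(t)=e^{\mathbb Bt}$ on $\mathcal H$, and this semigroup is analytic: for some $\omega\in(0,\pi/2]$ it extends to a family of bounded operators $S(\zeta)$, $|\arg\zeta|<\omega$, which is holomorphic in operator norm, satisfies $S(\zeta_1+\zeta_2)=S(\zeta_1)S(\zeta_2)$, and converges strongly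 to $I$ as $\zeta\to0$ in the sector. -/

import Mathlib

open MeasureTheory TopologicalSpace Filter
open scoped NNReal Topology InnerProductSpace Distributions

noncomputable section

/-! ## The Dirichlet Laplacian on a bounded open set -/

/-- The complex Hilbert space `L²(Ω)`. -/
abbrev L2 {n : ℕ} (Ω : Opens (EuclideanSpace ℝ (Fin n))) : Type :=
  Lp ℂ 2 ((volume : Measure (EuclideanSpace ℝ (Fin n))).restrict (Ω : Set _))

/-- The `L²`-classes of the pairs `(φ, ∇φ)`, where `φ` is a complex test function on `Ω`
(smooth with compact support in `Ω`). -/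
def testGradient {n : ℕ} (Ω : Opens (EuclideanSpace ℝ (Fin n))) :
    Submodule ℂ (L2 Ω × (Fin n → L2 Ω)) where
  carrier := {p | ∃ φ : 𝓓(Ω, ℂ),
    p.1 =ᵐ[volume.restrict (Ω : Set _)] (fun x => φ x) ∧
    ∀ i, p.2 i =ᵐ[volume.restrict (Ω : Set _)]
      (fun x => fderiv ℝ (fun y => φ y) x (EuclideanSpace.single i 1))}
  zero_mem' := by
    refine ⟨0, ?_, fun i => ?_⟩
    · filter_upwards [Lp.coeFn_zero ℂ 2
        ((volume : Measure (EuclideanSpace ℝ (Fin n))).restrict (Ω : Set _))] with x hx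
      exact hx
    · filter_upwards [Lp.coeFn_zero ℂ 2
        ((volume : Measure (EuclideanSpace ℝ (Fin n))).restrict (Ω : Set _))] with x hx
      refine hx.trans ?_
      simp
  add_mem' := by
    rintro p q ⟨φ, hφ, hφ'⟩ ⟨ψ, hψ, hψ'⟩
    refine ⟨φ + ψ, ?_, fun i => ?_⟩
    · filter_upwards [Lp.coeFn_add p.1 q.1, hφ, hψ] with x hx h1 h2
      refine hx.trans ?_
      simp [h1, h2]
    · filter_upwards [Lp.coeFn_add (p.2 i) (q.2 i), hφ' i, hψ' i] with x hx h1 h2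
      have hd : fderiv ℝ (fun y => (φ + ψ) y) x
          = fderiv ℝ (fun y => φ y) x + fderiv ℝ (fun y => ψ y) x :=
        fderiv_add (𝕜 := ℝ) (f := fun y => φ y) (g := fun y => ψ y) (x := x)
          ((φ.contDiff.differentiable (by simp)) x) ((ψ.contDiff.differentiable (by simp)) x)
      refine hx.trans ?_
      rw [hd]
      simp [h1, h2]
  smul_mem' := by
    rintro c p ⟨φ, hφ, hφ'⟩
    refine ⟨c • φ, ?_, fun i => ?_⟩
    · filter_upwards [Lp.coeFn_smul c p.1, hφ] with x hx h1
      refine hx.trans ?_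
      simp [h1]
    · filter_upwards [Lp.coeFn_smul c (p.2 i), hφ' i] with x hx h1
      have hd : fderiv ℝ (fun y => (c • φ) y) x = c • fderiv ℝ (fun y => φ y) x :=
        fderiv_const_smul (𝕜 := ℝ) (f := fun y => φ y) (x := x)
          ((φ.contDiff.differentiable (by simp)) x) c
      refine hx.trans ?_
      rw [hd]
      simp [h1]

/-- The pairs `(u, ∇u)` with `u ∈ H¹₀(Ω)`, the closure of the test functions in the `H¹` norm. -/
def sobolevH10 {n : ℕ} (Ω : Opens (EuclideanSpace ℝ (Fin n))) :
    Submodule ℂ (L2 Ω × (Fin n → L2 Ω)) :=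
  (testGradient Ω).topologicalClosure

/-- The graph of the Dirichlet Laplacian: the pairs `(u, f)` with `u ∈ H¹₀(Ω)`, `f ∈ L²(Ω)` and
`-Δu = f` in the sense of distributions, that is `∫ ∇u · ∇φ̄ = ∫ f φ̄` for every test
function `φ`. -/
def dirichletLaplacianGraph {n : ℕ} (Ω : Opens (EuclideanSpace ℝ (Fin n))) :
    Submodule ℂ (L2 Ω × L2 Ω) where
  carrier := {p | ∃ g : Fin n → L2 Ω, (p.1, g) ∈ sobolevH10 Ω ∧
    ∀ q ∈ testGradient Ω, ∑ i, ⟪q.2 i, g i⟫_ℂ = ⟪q.1, p.2⟫_ℂ}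
  zero_mem' := ⟨0, (sobolevH10 Ω).zero_mem, fun q _ => by simp⟩
  add_mem' := by
    rintro p p' ⟨g, hg, h⟩ ⟨g', hg', h'⟩
    refine ⟨g + g', (sobolevH10 Ω).add_mem hg hg', fun q hq => ?_⟩
    simp [inner_add_right, Finset.sum_add_distrib, h q hq, h' q hq]
  smul_mem' := by
    rintro c p ⟨g, hg, h⟩
    refine ⟨c • g, (sobolevH10 Ω).smul_mem c hg, fun q hq => ?_⟩
    simp [inner_smul_right, ← Finset.mul_sum, h q hq]

/-- The operator `A = -Δ` in `L²(Ω)` with Dirichlet boundary conditions,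
`D(A) = {u ∈ H¹₀(Ω) : Δu ∈ L²(Ω)}` (which is `H²(Ω) ∩ H¹₀(Ω)` if `∂Ω` is smooth). -/
def dirichletLaplacian {n : ℕ} (Ω : Opens (EuclideanSpace ℝ (Fin n))) : L2 Ω →ₗ.[ℂ] L2 Ω :=
  (dirichletLaplacianGraph Ω).toLinearPMap

/-! ## Fractional powers of a strictly positive self-adjoint operator -/

section Operators

variable {H : Type*} [NormedAddCommGroup H] [InnerProductSpace ℂ H] [CompleteSpace H]

/-- `T` is the bounded, everywhere defined inverse of `A`. -/
def IsBoundedInverse (A : H →ₗ.[ℂ] H) (T : H →L[ℂ] H) : Prop :=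
  (∀ f : H, ∃ h : T f ∈ A.domain, A ⟨T f, h⟩ = f) ∧ ∀ u : A.domain, T (A u) = u

open Classical in
/-- The bounded operator `A⁻¹` (it is determined by `A`; junk value `0` if it does not exist). -/
def boundedInverse (A : H →ₗ.[ℂ] H) : H →L[ℂ] H :=
  if h : ∃ T : H →L[ℂ] H, IsBoundedInverse A T then h.choose else 0

/-- The bounded operator `A⁻ˢ`, `s ≥ 0`, through the functional calculus of the bounded
positive operator `A⁻¹`. -/
def negPow (A : H →ₗ.[ℂ] H) (s : ℝ) : H →L[ℂ] H := (boundedInverse A) ^ s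

/-- The operator `Aˢ`, `s ≥ 0`: the inverse of `A⁻ˢ`, with domain `D(Aˢ)` the range of `A⁻ˢ`. -/
def fracPow (A : H →ₗ.[ℂ] H) (s : ℝ) : H →ₗ.[ℂ] H :=
  ((negPow A s : H →ₗ[ℂ] H).toPMap ⊤).inverse

end Operators

/-! ## The coupled plate / network system -/

/-- The coefficients of the system
`u'' + κ A^β u'' + α A² u + γ A v' = 0`, `v'' + α A v - γ A u' + δ A^θ v' = 0`. -/
structure Coefficients where
  α : ℝ
  κ : ℝ
  γ : ℝ
  δ : ℝ
  α_pos : 0 < α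
  κ_pos : 0 < κ
  γ_ne_zero : γ ≠ 0
  δ_pos : 0 < δ

section System

variable {H : Type*} [NormedAddCommGroup H] [InnerProductSpace ℂ H] [CompleteSpace H]

/-- The phase space `D(A) × D(A^{1/2}) × D(A^{β/2}) × H` of the vectors `U = (u, v, w, z)`. -/
def PhaseSpace (_c : Coefficients) (β : ℝ) (A : H →ₗ.[ℂ] H) : Type _ :=
  A.domain × (fracPow A (1 / 2)).domain × (fracPow A (β / 2)).domain × H

namespace PhaseSpace

variable {c : Coefficients} {β : ℝ} {A : H →ₗ.[ℂ] H}

instance : AddCommGroup (PhaseSpace c β A) :=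
  inferInstanceAs (AddCommGroup
    (A.domain × (fracPow A (1 / 2)).domain × (fracPow A (β / 2)).domain × H))

instance : Module ℂ (PhaseSpace c β A) :=
  inferInstanceAs (Module ℂ
    (A.domain × (fracPow A (1 / 2)).domain × (fracPow A (β / 2)).domain × H))

def u (U : PhaseSpace c β A) : A.domain := U.1
def v (U : PhaseSpace c β A) : (fracPow A (1 / 2)).domain := U.2.1
def w (U : PhaseSpace c β A) : (fracPow A (β / 2)).domain := U.2.2.1
def z (U : PhaseSpace c β A) : H := U.2.2.2

@[simp] theorem u_zero : (0 : PhaseSpace c β A).u = 0 := rfl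
@[simp] theorem v_zero : (0 : PhaseSpace c β A).v = 0 := rfl
@[simp] theorem w_zero : (0 : PhaseSpace c β A).w = 0 := rfl
@[simp] theorem z_zero : (0 : PhaseSpace c β A).z = 0 := rfl
@[simp] theorem u_add (U V : PhaseSpace c β A) : (U + V).u = U.u + V.u := rfl
@[simp] theorem v_add (U V : PhaseSpace c β A) : (U + V).v = U.v + V.v := rfl
@[simp] theorem w_add (U V : PhaseSpace c β A) : (U + V).w = U.w + V.w := rfl
@[simp] theorem z_add (U V : PhaseSpace c β A) : (U + V).z = U.z + V.z := rfl
@[simp] theorem u_smul (a : ℂ) (U : PhaseSpace c β A) : (a • U).u = a • U.u := rfl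
@[simp] theorem v_smul (a : ℂ) (U : PhaseSpace c β A) : (a • U).v = a • U.v := rfl
@[simp] theorem w_smul (a : ℂ) (U : PhaseSpace c β A) : (a • U).w = a • U.w := rfl
@[simp] theorem z_smul (a : ℂ) (U : PhaseSpace c β A) : (a • U).z = a • U.z := rfl

/-- The energy inner product of the phase space. -/
def energyInner (U V : PhaseSpace c β A) : ℂ :=
  c.α * ⟪A U.u, A V.u⟫_ℂ
    + c.α * ⟪fracPow A (1 / 2) U.v, fracPow A (1 / 2) V.v⟫_ℂ
    + ⟪(U.w : H), (V.w : H)⟫_ℂ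
    + c.κ * ⟪fracPow A (β / 2) U.w, fracPow A (β / 2) V.w⟫_ℂ
    + ⟪U.z, V.z⟫_ℂ

theorem energyInner_self (U : PhaseSpace c β A) :
    energyInner U U = ((c.α * ‖A U.u‖ ^ 2 + c.α * ‖fracPow A (1 / 2) U.v‖ ^ 2 + ‖(U.w : H)‖ ^ 2
      + c.κ * ‖fracPow A (β / 2) U.w‖ ^ 2 + ‖U.z‖ ^ 2 : ℝ) : ℂ) := by
  have h : ∀ x : H, ⟪x, x⟫_ℂ = ((‖x‖ ^ 2 : ℝ) : ℂ) := fun x => by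
    rw [inner_self_eq_norm_sq_to_K]; norm_cast
  simp only [energyInner, h, ← Complex.ofReal_mul, ← Complex.ofReal_add]

@[reducible] def core : PreInnerProductSpace.Core ℂ (PhaseSpace c β A) where
  inner := energyInner
  conj_inner_symm U V := by
    simp only [energyInner, map_add, map_mul, Complex.conj_ofReal, inner_conj_symm]
  re_inner_nonneg U := by
    have hα := c.α_pos.le
    have hκ := c.κ_pos.le
    rw [energyInner_self, RCLike.re_eq_complex_re, Complex.ofReal_re]
    positivity
  add_left U V W := by
    simp only [energyInner, u_add, v_add, w_add, z_add, LinearPMap.map_add, Submodule.coe_add,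
      inner_add_left]
    ring
  smul_left U V r := by
    simp only [energyInner, u_smul, v_smul, w_smul, z_smul, LinearPMap.map_smul,
      Submodule.coe_smul, inner_smul_left]
    ring

/-- The norm `‖U‖² = α‖Au‖² + α‖A^{1/2}v‖² + ‖w‖² + κ‖A^{β/2}w‖² + ‖z‖²`. (It is definite when
`A` is strictly positive and self-adjoint; the instance records only the seminorm axioms.) -/
instance : SeminormedAddCommGroup (PhaseSpace c β A) :=
  @InnerProductSpace.Core.toSeminormedAddCommGroup ℂ _ _ _ _ core

instance : InnerProductSpace ℂ (PhaseSpace c β A) := InnerProductSpace.ofCore core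

theorem norm_sq (U : PhaseSpace c β A) :
    ‖U‖ ^ 2 = c.α * ‖A U.u‖ ^ 2 + c.α * ‖fracPow A (1 / 2) U.v‖ ^ 2 + ‖(U.w : H)‖ ^ 2
      + c.κ * ‖fracPow A (β / 2) U.w‖ ^ 2 + ‖U.z‖ ^ 2 := by
  have h : ‖U‖ ^ 2 = RCLike.re (energyInner U U) := norm_sq_eq_re_inner (𝕜 := ℂ) U
  rw [h, energyInner_self, RCLike.re_eq_complex_re, Complex.ofReal_re]

end PhaseSpace

/-- The graph of the generator
`𝔹(u, v, w, z) = (w, z, -(I + κA^β)⁻¹(αA²u + γAz), -αAv + γAw - δA^θ z)`.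
A pair `(U, V)` belongs to it if and only if

* `w ∈ D(A)`, `z ∈ D(A^{1/2})`, and these are the first two components of `V`;
* the third component `p ∈ D(A^{β/2})` of `V` solves `(I + κA^β) p = -(αA²u + γAz)` in
  `D(A^{-β/2})`, the dual of `D(A^{β/2})`: for all `φ ∈ D(A)` (a dense subspace of `D(A^{β/2})`)
  `⟨p, φ⟩ + κ⟨A^{β/2}p, A^{β/2}φ⟩ = -α⟨Au, Aφ⟩ - γ⟨z, Aφ⟩`; by Riesz such a `p` exists if and only
  if `αA²u + γAz ∈ D(A^{-β/2})`;
* `αv + δA^{θ-1}z ∈ D(A)`, and the last component of `V` is `-A(αv + δA^{θ-1}z) + γAw`. -/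
def generatorGraph (c : Coefficients) (θ β : ℝ) (A : H →ₗ.[ℂ] H) :
    Submodule ℂ (PhaseSpace c β A × PhaseSpace c β A) where
  carrier := {p |
    (p.2.u : H) = p.1.w ∧ (p.2.v : H) = p.1.z ∧
    (∀ (φ : A.domain) (ψ : (fracPow A (β / 2)).domain), (φ : H) = ψ →
      ⟪(φ : H), (p.2.w : H)⟫_ℂ + c.κ * ⟪fracPow A (β / 2) ψ, fracPow A (β / 2) p.2.w⟫_ℂ
        = -c.α * ⟪A φ, A p.1.u⟫_ℂ - c.γ * ⟪A φ, p.1.z⟫_ℂ) ∧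
    ∃ y : A.domain, (y : H) = (c.α : ℂ) • (p.1.v : H) + (c.δ : ℂ) • negPow A (1 - θ) p.1.z ∧
      p.2.z = -A y + (c.γ : ℂ) • A p.2.u}
  zero_mem' := by
    refine ⟨by simp, by simp, fun φ ψ _ => by simp [LinearPMap.map_zero], 0, by simp, ?_⟩
    simp [LinearPMap.map_zero]
  add_mem' := by
    rintro p q ⟨h1, h2, h3, y, hy, h4⟩ ⟨k1, k2, k3, y', hy', k4⟩
    refine ⟨by simp [h1, k1], by simp [h2, k2], fun φ ψ e => ?_, y + y', ?_, ?_⟩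
    · have a := h3 φ ψ e
      have b := k3 φ ψ e
      simp only [Prod.fst_add, Prod.snd_add, PhaseSpace.u_add, PhaseSpace.w_add, PhaseSpace.z_add,
        LinearPMap.map_add, Submodule.coe_add, inner_add_right]
      linear_combination a + b
    · simp only [Prod.fst_add, PhaseSpace.v_add, PhaseSpace.z_add, Submodule.coe_add, hy, hy',
        map_add, smul_add]
      abel
    · simp only [Prod.snd_add, PhaseSpace.u_add, PhaseSpace.z_add, LinearPMap.map_add, h4, k4,
        smul_add]
      abel
  smul_mem' := by
    rintro a p ⟨h1, h2, h3, y, hy, h4⟩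
    refine ⟨by simp [h1], by simp [h2], fun φ ψ e => ?_, a • y, ?_, ?_⟩
    · have b := h3 φ ψ e
      simp only [Prod.smul_fst, Prod.smul_snd, PhaseSpace.u_smul, PhaseSpace.w_smul,
        PhaseSpace.z_smul, LinearPMap.map_smul, Submodule.coe_smul, inner_smul_right]
      linear_combination a * b
    · simp only [Prod.smul_fst, PhaseSpace.v_smul, PhaseSpace.z_smul, Submodule.coe_smul, hy,
        map_smul, smul_add, smul_comm a]
    · simp only [Prod.smul_snd, PhaseSpace.u_smul, PhaseSpace.z_smul, LinearPMap.map_smul, h4,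
        smul_add, smul_neg, smul_comm a]

/-- The operator `𝔹` in the phase space. -/
def generator (c : Coefficients) (θ β : ℝ) (A : H →ₗ.[ℂ] H) :
    PhaseSpace c β A →ₗ.[ℂ] PhaseSpace c β A :=
  (generatorGraph c θ β A).toLinearPMap

end System

/-! ## Resolvent set, semigroups, analyticity -/

section Semigroups

variable {X : Type*} [SeminormedAddCommGroup X] [NormedSpace ℂ X]

/-- The resolvent set of an unbounded operator: the `μ` for which `μI - B : D(B) → X` has a
bounded, everywhere defined inverse. -/
def resolventSetPMap (B : X →ₗ.[ℂ] X) : Set ℂ :=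
  {μ | ∃ R : X →L[ℂ] X, (∀ F : X, ∃ h : R F ∈ B.domain, μ • R F - B ⟨R F, h⟩ = F) ∧
    ∀ U : B.domain, R (μ • (U : X) - B U) = U}

/-- `S` is a `C₀`-semigroup of bounded operators whose infinitesimal generator is `B`
(that is, `S(t) = e^{Bt}`). -/
structure IsC0SemigroupGeneratedBy (B : X →ₗ.[ℂ] X) (S : ℝ≥0 → X →L[ℂ] X) : Prop where
  map_zero : S 0 = ContinuousLinearMap.id ℂ X
  map_add : ∀ s t : ℝ≥0, S (s + t) = (S s).comp (S t)
  tendsto_zero : ∀ x : X, Tendsto (fun t : ℝ≥0 => S t x) (𝓝 0) (𝓝 x)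
  generator : ∀ x y : X, (x, y) ∈ B.graph ↔
    Tendsto (fun t : ℝ≥0 => ((t : ℝ) : ℂ)⁻¹ • (S t x - x)) (𝓝[>] 0) (𝓝 y)

/-- The open sector `{z ≠ 0 : |arg z| < ω}`. -/
def openSector (ω : ℝ) : Set ℂ := {z | z ≠ 0 ∧ |z.arg| < ω}

/-- A semigroup `S` is analytic: it extends to a holomorphic (in operator norm), strongly
continuous at `0`, semigroup on some sector `{z ≠ 0 : |arg z| < ω}` with `0 < ω ≤ π/2`. -/
def IsAnalyticSemigroup (S : ℝ≥0 → X →L[ℂ] X) : Prop :=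
  ∃ ω : ℝ, 0 < ω ∧ ω ≤ Real.pi / 2 ∧ ∃ T : ℂ → X →L[ℂ] X,
    (∀ t : ℝ≥0, T ((t : ℝ) : ℂ) = S t) ∧
    DifferentiableOn ℂ T (openSector ω) ∧
    (∀ a ∈ openSector ω, ∀ b ∈ openSector ω, T (a + b) = (T a).comp (T b)) ∧
    ∀ x : X, Tendsto (fun a => T a x) (𝓝[openSector ω] 0) (𝓝 x)

end Semigroups

end

/-! For `β = 1` and `θ = 1/2` every coupling has the same order. In the coordinates `x = (Au,
A^{1/2}v, A^{1/2}w, z)`, which identify the phase space with `H⁴` up to an equivalent norm, the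
generator is `A^{1/2}M` with `M` a bounded matrix: the inertia term contributes only the bounded
operator `A(I + κA)⁻¹ = (κ + A⁻¹)⁻¹`. With `R = A^{-1/4}` acting diagonally, the generator is
`R⁻²M`, where `R` is self-adjoint, injective and commutes with `M`.

Everything then follows from one strict Lyapunov form: a bounded, self-adjoint, coercive `P`
commuting with `R` and satisfying `Re⟨PMx, x⟩ ≤ -c‖x‖²` (`exists_isLyapunovTriple`). The energy
alone dissipates only `z`. A large multiple of it plus suitable cross terms dissipates all four
components, and `γ ≠ 0` is what transmits the damping to `u` and `w`.

Resolvent (`exists_resolvent`): for `Re μ ≥ 0` the operator `μR² - M` is coercive in the form `P`,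
since `Re⟨PμR²x, x⟩ = Re μ ⟨PRx, Rx⟩ ≥ 0`. Its inverse `J` is bounded uniformly in `μ`, the
resolvent is `R²J`, and `μR²J = 1 + MJ` gives the decay `1/|μ|`.

Semigroup: the numerical values `⟨PMx, x⟩` lie in a sector strictly inside the left half plane, so
the dissipation survives multiplication by `ζ` in a small cone. The bounded approximations `B_ε =
(R² + ε)⁻¹M` therefore have exponentials bounded uniformly on that cone (`norm_exp_approx_le`).
Cauchy's estimate bounds `B_ε exp(ζB_ε)` by a multiple of `1/Re ζ`, and a Duhamel argument makes
`exp(ζB_ε)` converge in operator norm along `ε = 2⁻ⁿ`, locally uniformly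
(`exists_norm_exp_approx_sub_le`). The limit is the holomorphic semigroup generated by `R⁻²M`
(`graph_iff_tendsto`).

Finally, the Poincaré inequality and the weak formulation give the Dirichlet Laplacian on a bounded
open set a bounded, positive, injective inverse (`exists_isBoundedInverse_dirichletLaplacian`), the
only property of `A` that is used. -/

noncomputable section

/-! ### Lyapunov forms and uniformly bounded approximations. -/

section LyapunovSemigroup

set_option linter.unusedSectionVars false

variable {K : Type*} [NormedAddCommGroup K] [InnerProductSpace ℂ K] [CompleteSpace K]

theorem hasDerivAt_exp_ofReal_smul_apply (D : K →L[ℂ] K) (x : K) (t : ℝ) :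
    HasDerivAt (fun s : ℝ => NormedSpace.exp ((s : ℂ) • D) x)
      (D (NormedSpace.exp ((t : ℂ) • D) x)) t := by
  have h := (hasDerivAt_exp_smul_const' (𝕂 := ℂ) D (t : ℂ)).clm_apply (hasDerivAt_const (t : ℂ) x)
  simpa [Function.comp_def] using h.scomp t Complex.ofRealCLM.hasDerivAt

/-- A Lyapunov functional that does not increase along the flow of `D` bounds `exp D`. -/
theorem norm_exp_le_of_lyapunov {P D : K →L[ℂ] K} {m : ℝ} (hm : 0 < m) (hP : IsSelfAdjoint P)
    (hlow : ∀ x, m * ‖x‖ ^ 2 ≤ (⟪P x, x⟫_ℂ).re) (hD : ∀ x, (⟪P (D x), x⟫_ℂ).re ≤ 0) :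
    ‖NormedSpace.exp D‖ ≤ √(‖P‖ / m) := by
  refine ContinuousLinearMap.opNorm_le_bound _ (Real.sqrt_nonneg _) fun x => ?_
  set y : ℝ → K := fun s => NormedSpace.exp ((s : ℂ) • D) x with hy
  have hder : ∀ t, HasDerivAt (fun s => (⟪P (y s), y s⟫_ℂ).re) (2 * (⟪P (D (y t)), y t⟫_ℂ).re) t := by
    intro t
    have h1 := hasDerivAt_exp_ofReal_smul_apply D x t
    have h2 := ((P.restrictScalars ℝ).hasFDerivAt (x := y t)).comp_hasDerivAt t h1
    have h3 := (h2.inner ℂ h1)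
    have h4 := (Complex.reCLM.hasFDerivAt).comp_hasDerivAt t h3
    convert! h4 using 1
    simp only [Function.comp, ContinuousLinearMap.coe_restrictScalars', Complex.reCLM_apply,
      Complex.add_re]
    have h5 : ⟪P (y t), D (y t)⟫_ℂ = ⟪y t, P (D (y t))⟫_ℂ :=
      hP.isSymmetric _ _
    have h6 : (⟪y t, P (D (y t))⟫_ℂ).re = (⟪P (D (y t)), y t⟫_ℂ).re := by
      rw [← inner_conj_symm, Complex.conj_re]
    rw [two_mul]
    congr 1
    rw [← h6, ← h5]
  -- Comparing the form at times 0 and 1 gives `m‖exp(D)x‖² ≤ ⟪Px, x⟫ ≤ ‖P‖‖x‖²`.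
  have hanti : Antitone (fun s => (⟪P (y s), y s⟫_ℂ).re) :=
    antitone_of_deriv_nonpos (fun t => (hder t).differentiableAt) fun t => by
      rw [(hder t).deriv]; linarith [hD (y t)]
  have h01 := hanti zero_le_one
  have hy0 : y 0 = x := by simp [hy]
  have hy1 : y 1 = NormedSpace.exp D x := by simp [hy]
  simp only [hy0, hy1] at h01
  have hup : (⟪P x, x⟫_ℂ).re ≤ ‖P‖ * ‖x‖ ^ 2 := by
    calc (⟪P x, x⟫_ℂ).re ≤ ‖⟪P x, x⟫_ℂ‖ := Complex.re_le_norm _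
      _ ≤ ‖P x‖ * ‖x‖ := norm_inner_le_norm _ _
      _ ≤ ‖P‖ * ‖x‖ * ‖x‖ := by gcongr; exact P.le_opNorm x
      _ = _ := by ring
  have h3 := hlow (NormedSpace.exp D x)
  refine abs_le_of_sq_le_sq' ?_ (by positivity) |>.2
  rw [mul_pow, Real.sq_sqrt (by positivity), div_mul_eq_mul_div, le_div_iff₀ hm]
  linarith

/-- `P` defines a Lyapunov functional for the formal generator `S⁻¹M`, `S = R²`. -/
structure IsLyapunovTriple (R M P : K →L[ℂ] K) (m c : ℝ) : Prop where
  m_pos : 0 < m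
  c_pos : 0 < c
  selfAdjoint_R : IsSelfAdjoint R
  injective_R : Function.Injective R
  comm_M : Commute R M
  comm_P : Commute R P
  selfAdjoint_P : IsSelfAdjoint P
  lower : ∀ x, m * ‖x‖ ^ 2 ≤ (⟪P x, x⟫_ℂ).re
  dissipative : ∀ x, (⟪P (M x), x⟫_ℂ).re ≤ -c * ‖x‖ ^ 2

theorem isUnit_of_re_inner_ge {D : K →L[ℂ] K} {c : ℝ} (hc : 0 < c)
    (h : ∀ x, c * ‖x‖ ^ 2 ≤ |(⟪D x, x⟫_ℂ).re|) : IsUnit D := by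
  refine ContinuousLinearMap.isUnit_of_forall_le_norm_inner_map D (c := ⟨c, hc.le⟩) hc fun x => ?_
  rw [mul_comm]
  exact (h x).trans (Complex.abs_re_le_norm _)

/-- The cone `|Im ζ| ≤ τ Re ζ`. -/
def closedCone (τ : ℝ) : Set ℂ := {ζ | |ζ.im| ≤ τ * ζ.re}

theorem Commute.ringInverse_left' {A : Type*} [MonoidWithZero A] {a b : A} (h : Commute a b) :
    Commute (Ring.inverse a) b := by
  by_cases ha : IsUnit a
  · obtain ⟨u, rfl⟩ := ha
    rw [Ring.inverse_unit]
    exact h.units_inv_left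
  · rw [Ring.inverse_non_unit _ ha]
    exact Commute.zero_left _

namespace IsLyapunovTriple

variable {R M P : K →L[ℂ] K} {m c : ℝ}

/-- The bounded approximation `(R² + ε)⁻¹ M` of the formal generator `R⁻²M`. -/
def approx (R M : K →L[ℂ] K) (ε : ℝ) : K →L[ℂ] K := Ring.inverse (R * R + (ε : ℂ) • 1) * M

/-- Half the opening of the cone on which the semigroup is bounded. -/
def slope (M P : K →L[ℂ] K) (c : ℝ) : ℝ := c / (2 * (‖P‖ * ‖M‖ + c))

variable (h : IsLyapunovTriple R M P m c)
include h

theorem slope_pos : 0 < slope M P c := by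
  have := h.c_pos
  unfold slope
  positivity

theorem slope_le : slope M P c ≤ 1 / 2 := by
  have := h.c_pos
  have : 0 ≤ ‖P‖ * ‖M‖ := by positivity
  unfold slope
  rw [div_le_iff₀ (by positivity)]
  linarith

theorem inner_R_left (x y : K) : ⟪R x, y⟫_ℂ = ⟪x, R y⟫_ℂ :=
  h.selfAdjoint_R.isSymmetric _ _

theorem norm_inner_PM_le (x : K) : ‖⟪P (M x), x⟫_ℂ‖ ≤ ‖P‖ * ‖M‖ * ‖x‖ ^ 2 := by
  calc ‖⟪P (M x), x⟫_ℂ‖ ≤ ‖P (M x)‖ * ‖x‖ := norm_inner_le_norm _ _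
    _ ≤ ‖P‖ * (‖M‖ * ‖x‖) * ‖x‖ := by
      gcongr
      exact (P.le_opNorm _).trans (by gcongr; exact M.le_opNorm x)
    _ = _ := by ring

/-- With `a = ⟪PMx, x⟫` and `L = ‖P‖‖M‖`, the real part is `Re ζ Re a + Im ζ Im a`, at most `(-c Re
ζ + L|Im ζ|)‖x‖²`. The cone has slope `c/(L + c)`, which makes this nonpositive; the extra `c` in
the denominator covers `L = 0` and keeps the slope bounded. -/
theorem re_smul_inner_nonpos {ζ : ℂ} (hζ : ζ ∈ closedCone (2 * slope M P c)) (x : K) :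
    (⟪ζ • P (M x), x⟫_ℂ).re ≤ 0 := by
  have h1 := h.dissipative x
  have h2 := (Complex.abs_im_le_norm _).trans (h.norm_inner_PM_le x)
  have hc := h.c_pos
  set a := ⟪P (M x), x⟫_ℂ
  have hL : 0 ≤ ‖P‖ * ‖M‖ := by positivity
  set L := ‖P‖ * ‖M‖
  have hs : 2 * slope M P c = c / (L + c) := by
    unfold slope; field_simp; rfl
  have hζ' : |ζ.im| ≤ c / (L + c) * ζ.re := by rw [← hs]; exact hζ
  have hre : 0 ≤ ζ.re := by
    have := (abs_nonneg _).trans hζ'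
    by_contra! hneg
    have : c / (L + c) * ζ.re < 0 := mul_neg_of_pos_of_neg (by positivity) hneg
    linarith
  have him : |ζ.im| * L ≤ c * ζ.re := by
    calc |ζ.im| * L ≤ c / (L + c) * ζ.re * L := by gcongr
      _ = (c * ζ.re) * (L / (L + c)) := by ring
      _ ≤ (c * ζ.re) * 1 := by
        gcongr
        rw [div_le_one (by positivity)]; linarith
      _ = _ := mul_one _
  rw [inner_smul_left, Complex.mul_re, Complex.conj_re, Complex.conj_im]
  have h3 : ζ.im * a.im ≤ |ζ.im| * (L * ‖x‖ ^ 2) := by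
    calc ζ.im * a.im ≤ |ζ.im * a.im| := le_abs_self _
      _ = |ζ.im| * |a.im| := abs_mul _ _
      _ ≤ _ := by gcongr
  have h4 : ζ.re * a.re ≤ ζ.re * (-c * ‖x‖ ^ 2) := by gcongr
  nlinarith [mul_le_mul_of_nonneg_right him (sq_nonneg ‖x‖), abs_nonneg (ζ.im), neg_abs_le (ζ.im * a.im), h3]

theorem re_inner_shift (ε : ℝ) (x : K) :
    (⟪(R * R + (ε : ℂ) • 1) x, x⟫_ℂ).re = ‖R x‖ ^ 2 + ε * ‖x‖ ^ 2 := by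
  have h1 : ⟪R (R x), x⟫_ℂ = ((‖R x‖ ^ 2 : ℝ) : ℂ) := by
    rw [h.inner_R_left, inner_self_eq_norm_sq_to_K]; norm_cast
  have h2 : ⟪x, x⟫_ℂ = ((‖x‖ ^ 2 : ℝ) : ℂ) := by
    rw [inner_self_eq_norm_sq_to_K]; norm_cast
  simp [h1, ← Complex.ofReal_pow]

theorem isUnit_shift {ε : ℝ} (hε : 0 < ε) : IsUnit (R * R + (ε : ℂ) • (1 : K →L[ℂ] K)) := by
  refine isUnit_of_re_inner_ge hε fun x => ?_
  rw [h.re_inner_shift]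
  exact le_trans (by nlinarith [sq_nonneg ‖R x‖]) (le_abs_self _)

theorem shift_apply_inverse {ε : ℝ} (hε : 0 < ε) (x : K) :
    (R * R + (ε : ℂ) • (1 : K →L[ℂ] K)) (Ring.inverse (R * R + (ε : ℂ) • 1) x) = x := by
  have := congrArg (fun D : K →L[ℂ] K => D x) (Ring.mul_inverse_cancel _ (h.isUnit_shift hε))
  simpa using this

/-- The squared norm expands as `‖R²x‖² + 2δ‖Rx‖² + δ²‖x‖²`, which is increasing in `δ ≥ 0`. -/
theorem norm_shift_mono {ε η : ℝ} (hε : 0 ≤ ε) (hεη : ε ≤ η) (x : K) :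
    ‖(R * R + (ε : ℂ) • (1 : K →L[ℂ] K)) x‖ ≤ ‖(R * R + (η : ℂ) • (1 : K →L[ℂ] K)) x‖ := by
  have key : ∀ δ : ℝ, ‖(R * R + (δ : ℂ) • (1 : K →L[ℂ] K)) x‖ ^ 2
      = ‖R (R x)‖ ^ 2 + 2 * δ * ‖R x‖ ^ 2 + δ ^ 2 * ‖x‖ ^ 2 := by
    intro δ
    have h1 : (⟪R (R x), x⟫_ℂ).re = ‖R x‖ ^ 2 := by
      rw [h.inner_R_left, inner_self_eq_norm_sq_to_K]; norm_cast
    have h2 : (R * R + (δ : ℂ) • (1 : K →L[ℂ] K)) x = R (R x) + (δ : ℂ) • x := by simp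
    rw [h2, norm_add_sq (𝕜 := ℂ), inner_smul_right, norm_smul, RCLike.re_eq_complex_re,
      Complex.re_ofReal_mul, h1, Complex.norm_real, mul_pow, Real.norm_eq_abs, sq_abs]
    ring
  refine abs_le_of_sq_le_sq' ?_ (norm_nonneg _) |>.2
  rw [key, key]
  gcongr

theorem norm_S_inverse_shift_le {ε : ℝ} (hε : 0 < ε) (x : K) :
    ‖R (R (Ring.inverse (R * R + (ε : ℂ) • (1 : K →L[ℂ] K)) x))‖ ≤ ‖x‖ := by
  have := h.norm_shift_mono le_rfl hε.le (Ring.inverse (R * R + (ε : ℂ) • (1 : K →L[ℂ] K)) x)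
  rw [h.shift_apply_inverse hε] at this
  simpa using this

omit h in
theorem commute_shift {D : K →L[ℂ] K} (hD : Commute R D) (ε : ℝ) :
    Commute (R * R + (ε : ℂ) • (1 : K →L[ℂ] K)) D :=
  (hD.mul_left hD).add_left ((Commute.one_left D).smul_left _)

omit h in
theorem commute_approx_left {D : K →L[ℂ] K} (hR : Commute R D) (hM : Commute M D) (ε : ℝ) :
    Commute (approx R M ε) D :=
  (commute_shift hR ε).ringInverse_left'.mul_left hM

theorem approx_comm (ε η : ℝ) : Commute (approx R M ε) (approx R M η) := by
  refine commute_approx_left ?_ ?_ ε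
  · exact (commute_approx_left (Commute.refl R) h.comm_M.symm η).symm
  · exact (commute_approx_left h.comm_M (Commute.refl M) η).symm

theorem shift_mul_approx {ε : ℝ} (hε : 0 < ε) :
    (R * R + (ε : ℂ) • 1) * approx R M ε = M := by
  rw [approx, ← mul_assoc, Ring.mul_inverse_cancel _ (h.isUnit_shift hε), one_mul]

/-- Writing `x = (R² + ε)y` turns `⟪Pζ B_ε x, x⟫` into `⟪ζPM(Ry), Ry⟫ + ε⟪ζPMy, y⟫`, because `R` is
symmetric and commutes with `P` and `M`. Both terms have nonpositive real part on the cone, so the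
bound does not depend on `ε`. -/
theorem norm_exp_approx_le {ε : ℝ} (hε : 0 < ε) {ζ : ℂ}
    (hζ : ζ ∈ closedCone (2 * slope M P c)) :
    ‖NormedSpace.exp (ζ • approx R M ε)‖ ≤ √(‖P‖ / m) := by
  refine norm_exp_le_of_lyapunov h.m_pos h.selfAdjoint_P h.lower fun x => ?_
  set y := Ring.inverse (R * R + (ε : ℂ) • (1 : K →L[ℂ] K)) x with hy
  have hx : x = R (R y) + (ε : ℂ) • y := by
    have := h.shift_apply_inverse hε x
    rw [← hy] at this
    rw [← this]; simp
  have h1 : approx R M ε x = M y := by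
    have : approx R M ε = M * Ring.inverse (R * R + (ε : ℂ) • (1 : K →L[ℂ] K)) :=
      (commute_shift h.comm_M ε).ringInverse_left'.eq
    rw [this]; rfl
  have hPM : R (P (M y)) = P (M (R y)) := by
    have e1 := congrArg (fun D : K →L[ℂ] K => D y) (h.comm_P.mul_right h.comm_M).eq
    simpa using e1
  have h2 : P ((ζ • approx R M ε) x) = ζ • P (M y) := by
    rw [smul_apply, h1, map_smul]
  rw [h2, hx, inner_add_right, inner_smul_right, ← h.inner_R_left, map_smul, hPM, Complex.add_re,
    Complex.re_ofReal_mul]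
  nlinarith [h.re_smul_inner_nonpos hζ (R y), h.re_smul_inner_nonpos hζ y]

end IsLyapunovTriple

end LyapunovSemigroup

/-! ### Smoothing estimates for the approximations, uniform in `ε`. -/

section LyapunovSemigroup

set_option linter.unusedSectionVars false

variable {K : Type*} [NormedAddCommGroup K] [InnerProductSpace ℂ K] [CompleteSpace K]

theorem exp_add_of_commute_clm {D D' : K →L[ℂ] K} (hc : Commute D D') :
    NormedSpace.exp (D + D') = NormedSpace.exp D * NormedSpace.exp D' := by
  let _ : NormedAlgebra ℚ (K →L[ℂ] K) := .restrictScalars ℚ ℂ (K →L[ℂ] K)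
  exact NormedSpace.exp_add_of_commute hc

/-- Duhamel's principle: the path `f(t) = exp(tD) exp((1-t)D')` joins the two exponentials and
satisfies `f' = (D - D')f`. -/
theorem norm_exp_sub_exp_le {D D' : K →L[ℂ] K} (hc : Commute D D') {C : ℝ}
    (h : ∀ t : ℝ, 0 ≤ t → t ≤ 1 → ‖(D - D') * (NormedSpace.exp ((t : ℂ) • D) *
      NormedSpace.exp (((1 - t : ℝ) : ℂ) • D'))‖ ≤ C) :
    ‖NormedSpace.exp D - NormedSpace.exp D'‖ ≤ C := by
  set f : ℝ → K →L[ℂ] K := fun t => NormedSpace.exp ((t : ℂ) • D) *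
      NormedSpace.exp (((1 - t : ℝ) : ℂ) • D') with hf
  have hder : ∀ t : ℝ, HasDerivAt f ((D - D') * f t) t := by
    intro t
    have h1 := (hasDerivAt_exp_smul_const' (𝕂 := ℂ) D (t : ℂ)).scomp t
      Complex.ofRealCLM.hasDerivAt
    have h0 : HasDerivAt (fun s : ℝ => ((1 - s : ℝ) : ℂ)) (-1) t := by
      simpa using ((hasDerivAt_id t).const_sub 1).ofReal_comp
    have h2 := (hasDerivAt_exp_smul_const' (𝕂 := ℂ) D' ((1 - t : ℝ) : ℂ)).scomp t h0
    have h3 := h1.mul h2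
    convert! h3 using 1
    have hcc : Commute D' (NormedSpace.exp ((t : ℂ) • D)) := (hc.symm.smul_right _).exp_right
    simp only [hf, Function.comp, Complex.ofRealCLM_apply, Complex.ofReal_one, one_smul, neg_smul,
      mul_neg]
    rw [← mul_assoc (NormedSpace.exp ((t : ℂ) • D)) D', ← hcc.eq]
    noncomm_ring
  have := norm_image_sub_le_of_norm_deriv_le_segment_01' (f := f) (C := C)
    (fun t _ => (hder t).hasDerivWithinAt) (fun t ht => h t ht.1 ht.2.le)
  simpa [hf] using this

namespace IsLyapunovTriple

variable {R M P : K →L[ℂ] K} {m c : ℝ}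

variable (h : IsLyapunovTriple R M P m c)
include h

/-- Both `P` and `PM` are invertible, their numerical ranges being bounded away from zero. -/
theorem isUnit_M : IsUnit M := by
  have hP : IsUnit P := isUnit_of_re_inner_ge h.m_pos fun x => (h.lower x).trans (le_abs_self _)
  have hPM : IsUnit (P * M) := isUnit_of_re_inner_ge h.c_pos fun x => by
    refine le_trans ?_ (neg_le_abs _)
    have := h.dissipative x
    change _ ≤ -(⟪P (M x), x⟫_ℂ).re
    linarith
  obtain ⟨u, rfl⟩ := hP
  exact (Units.isUnit_units_mul u M).1 hPM

/-- Makes room for Cauchy's estimate: with `s` the slope, `|Im w| ≤ (3s/2) Re ζ` and `Re w ≥ (1 -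
s/2) Re ζ`, and `3s/2 ≤ 2s(1 - s/2)` because `s ≤ 1/2`. -/
theorem mem_closedCone_of_dist_le {ζ w : ℂ} (hζ : ζ ∈ closedCone (slope M P c))
    (hre : 0 < ζ.re) (hw : ‖w - ζ‖ ≤ slope M P c / 2 * ζ.re) :
    w ∈ closedCone (2 * slope M P c) := by
  have h0 := h.slope_pos
  have h1 := h.slope_le
  have h2 := (Complex.abs_re_le_norm _).trans hw
  have h3 := (Complex.abs_im_le_norm _).trans hw
  simp only [closedCone, Set.mem_ofPred_eq, Complex.sub_re, Complex.sub_im] at *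
  set s := slope M P c
  have h4 := neg_le_of_abs_le h2
  have h5 : |w.im| ≤ |w.im - ζ.im| + |ζ.im| := by
    simpa using abs_add_le (w.im - ζ.im) ζ.im
  have h6 : (1 - s / 2) * ζ.re ≤ w.re := by linarith
  have h7 : s * ((1 - s / 2) * ζ.re) ≤ s * w.re := by gcongr
  nlinarith [mul_nonneg (mul_nonneg h0.le hre.le) (sub_nonneg.2 h1)]

theorem smul_mem_closedCone {τ t : ℝ} (ht : 0 ≤ t) {ζ : ℂ} (hζ : ζ ∈ closedCone τ) :
    (t : ℂ) * ζ ∈ closedCone τ := by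
  simp only [closedCone, Set.mem_ofPred_eq, Complex.re_ofReal_mul, Complex.im_ofReal_mul, abs_mul,
    abs_of_nonneg ht] at *
  nlinarith

theorem closedCone_subset : closedCone (slope M P c) ⊆ closedCone (2 * slope M P c) := by
  intro ζ hζ
  have h0 := h.slope_pos
  simp only [closedCone, Set.mem_ofPred_eq] at *
  have : 0 ≤ slope M P c * ζ.re := (abs_nonneg _).trans hζ
  linarith

/-- The operator is the complex derivative of `exp(ζB_ε)`, and the exponential is uniformly bounded
on the circle of radius `(s/2) Re ζ` about `ζ`, so Cauchy's estimate applies. -/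
theorem norm_approx_mul_exp_le {ε : ℝ} (hε : 0 < ε) {ζ : ℂ}
    (hζ : ζ ∈ closedCone (slope M P c)) (hre : 0 < ζ.re) :
    ‖approx R M ε * NormedSpace.exp (ζ • approx R M ε)‖
      ≤ √(‖P‖ / m) / (slope M P c / 2 * ζ.re) := by
  have h0 := h.slope_pos
  have hd := hasDerivAt_exp_smul_const' (𝕂 := ℂ) (approx R M ε) ζ
  rw [← hd.deriv]
  refine Complex.norm_deriv_le_of_forall_mem_sphere_norm_le (by positivity) ?_ fun w hw => ?_
  · exact (differentiable_exp_smul_const ℂ (approx R M ε)).diffContOnCl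
  · refine h.norm_exp_approx_le hε (h.mem_closedCone_of_dist_le hζ hre ?_)
    rw [← dist_eq_norm]
    exact (Metric.mem_sphere.1 hw).le

/-- Half of the exponential is spent on each factor: `B²exp(ζB) = (B exp(ζB/2))²`. -/
theorem norm_approx_sq_mul_exp_le {ε : ℝ} (hε : 0 < ε) {ζ : ℂ}
    (hζ : ζ ∈ closedCone (slope M P c)) (hre : 0 < ζ.re) :
    ‖approx R M ε * approx R M ε * NormedSpace.exp (ζ • approx R M ε)‖
      ≤ (√(‖P‖ / m) / (slope M P c / 4 * ζ.re)) ^ 2 := by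
  set B := approx R M ε
  have hz : (((1 / 2 : ℝ) : ℂ) * ζ) ∈ closedCone (slope M P c) :=
    h.smul_mem_closedCone (by norm_num) hζ
  have hzre : (((1 / 2 : ℝ) : ℂ) * ζ).re = ζ.re / 2 := by rw [Complex.re_ofReal_mul]; ring
  have h1 := h.norm_approx_mul_exp_le hε hz (by rw [hzre]; positivity)
  have h2 : B * B * NormedSpace.exp (ζ • B)
      = (B * NormedSpace.exp ((((1 / 2 : ℝ) : ℂ) * ζ) • B))
        * (B * NormedSpace.exp ((((1 / 2 : ℝ) : ℂ) * ζ) • B)) := by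
    have e1 : ζ • B = (((1 / 2 : ℝ) : ℂ) * ζ) • B + (((1 / 2 : ℝ) : ℂ) * ζ) • B := by
      rw [← add_smul]; congr 1; push_cast; ring
    have e2 : Commute B (NormedSpace.exp ((((1 / 2 : ℝ) : ℂ) * ζ) • B)) :=
      ((Commute.refl B).smul_right _).exp_right
    rw [e1, exp_add_of_commute_clm (Commute.refl _)]
    set E := NormedSpace.exp ((((1 / 2 : ℝ) : ℂ) * ζ) • B)
    calc B * B * (E * E) = B * (B * E) * E := by noncomm_ring
      _ = B * (E * B) * E := by rw [e2.eq]
      _ = _ := by noncomm_ring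
  rw [h2, sq]
  refine (norm_mul_le _ _).trans ?_
  have h3 : slope M P c / 2 * (((1 / 2 : ℝ) : ℂ) * ζ).re = slope M P c / 4 * ζ.re := by
    rw [hzre]; ring
  rw [h3] at h1
  exact mul_le_mul h1 h1 (norm_nonneg _) ((norm_nonneg _).trans h1)

/-- The quotient is `G = (R² + ε)(R² + η)⁻¹`. For `x = (R² + η)y`, monotonicity in the shift gives
`‖(R² + ε)y‖ ≤ ‖(R² + 2η)y‖ = ‖x + ηy‖`, and `η‖y‖ ≤ ‖x‖`. The hypothesis `ε ≤ 2η` accommodates both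
orders of the pair `ε`, `ε/2`. -/
theorem norm_approx_ratio {ε η : ℝ} (hε : 0 < ε) (hη : 0 < η) (hle : ε ≤ 2 * η) :
    ∃ G : K →L[ℂ] K, ‖G‖ ≤ 2 ∧ approx R M η = G * approx R M ε := by
  refine ⟨(R * R + (ε : ℂ) • 1) * Ring.inverse (R * R + (η : ℂ) • (1 : K →L[ℂ] K)), ?_, ?_⟩
  · refine ContinuousLinearMap.opNorm_le_bound _ (by norm_num) fun x => ?_
    set y := Ring.inverse (R * R + (η : ℂ) • (1 : K →L[ℂ] K)) x with hy
    have hx : (R * R + (η : ℂ) • (1 : K →L[ℂ] K)) y = x := h.shift_apply_inverse hη x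
    have h1 := h.norm_shift_mono hε.le hle y
    have h3 : (R * R + ((2 * η : ℝ) : ℂ) • (1 : K →L[ℂ] K)) y = x + (η : ℂ) • y := by
      rw [← hx]
      simp only [add_apply, smul_apply, one_apply_eq_self]
      push_cast
      rw [mul_smul, two_smul]
      abel
    have h4 : ‖(η : ℂ) • y‖ ≤ ‖x‖ := by
      have h5 := h.re_inner_shift η y
      rw [hx] at h5
      have h6 := (Complex.re_le_norm _).trans (norm_inner_le_norm (𝕜 := ℂ) x y)
      rw [h5] at h6
      rw [norm_smul, Complex.norm_real, Real.norm_of_nonneg hη.le]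
      rcases (norm_nonneg y).eq_or_lt with hy0 | hy0
      · rw [← hy0]; simp
      · nlinarith [sq_nonneg ‖R y‖]
    calc _ = ‖(R * R + (ε : ℂ) • (1 : K →L[ℂ] K)) y‖ := rfl
      _ ≤ ‖x + (η : ℂ) • y‖ := by rw [← h3]; exact h1
      _ ≤ 2 * ‖x‖ := by linarith [norm_add_le x ((η : ℂ) • y)]
  · have hcomm : Commute (R * R + (ε : ℂ) • (1 : K →L[ℂ] K))
        (Ring.inverse (R * R + (η : ℂ) • (1 : K →L[ℂ] K))) := by
      refine commute_shift ?_ ε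
      exact (commute_shift (Commute.refl R) η).ringInverse_left'.symm
    rw [hcomm.eq, mul_assoc, h.shift_mul_approx hε, approx]

/-- A resolvent identity: the small factor `η - ε` is paid for by a product of two approximations,
which the smoothing estimates absorb. -/
theorem approx_sub_approx {ε η : ℝ} (hε : 0 < ε) (hη : 0 < η) :
    approx R M ε - approx R M η
      = ((η - ε : ℝ) : ℂ) • (Ring.inverse M * (approx R M ε * approx R M η)) := by
  have hc1 : Commute M (approx R M ε) :=
    (commute_approx_left h.comm_M (Commute.refl M) ε).symm
  set A₁ := R * R + (ε : ℂ) • (1 : K →L[ℂ] K) with hA₁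
  set A₂ := R * R + (η : ℂ) • (1 : K →L[ℂ] K) with hA₂
  have h1 : A₁ * approx R M ε = M := h.shift_mul_approx hε
  have h2 : A₂ * approx R M η = M := h.shift_mul_approx hη
  have h1' : approx R M ε * A₁ = M := by
    refine Eq.trans ?_ h1
    exact ((commute_shift (commute_approx_left (Commute.refl R) h.comm_M.symm ε).symm ε).eq).symm
  have h12 : A₂ - A₁ = ((η - ε : ℝ) : ℂ) • 1 := by
    rw [hA₁, hA₂]; push_cast; module
  have key : M * (approx R M ε - approx R M η)
      = ((η - ε : ℝ) : ℂ) • (approx R M ε * approx R M η) := by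
    calc M * (approx R M ε - approx R M η)
        = approx R M ε * M - M * approx R M η := by rw [mul_sub, hc1.eq]
      _ = approx R M ε * (A₂ * approx R M η) - approx R M ε * A₁ * approx R M η := by
        rw [h2, h1']
      _ = approx R M ε * ((A₂ - A₁) * approx R M η) := by noncomm_ring
      _ = _ := by rw [h12]; simp
  have h3 : Ring.inverse M * M = 1 := Ring.inverse_mul_cancel _ h.isUnit_M
  rw [← mul_smul_comm, ← key, ← mul_assoc, h3, one_mul]

end IsLyapunovTriple

end LyapunovSemigroup

/-! ### The limit semigroup, its holomorphy and its generator; the uniform resolvent. -/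

section LyapunovSemigroup

set_option linter.unusedSectionVars false

variable {K : Type*} [NormedAddCommGroup K] [InnerProductSpace ℂ K] [CompleteSpace K]

/-- The open cone `|Im ζ| < τ Re ζ`. -/
def openCone (τ : ℝ) : Set ℂ := {ζ | |ζ.im| < τ * ζ.re}

theorem isOpen_openCone (τ : ℝ) : IsOpen (openCone τ) :=
  isOpen_lt (by fun_prop) (by fun_prop)

theorem openCone_subset_closedCone (τ : ℝ) : openCone τ ⊆ closedCone τ := fun ζ hζ =>
  (show |ζ.im| < τ * ζ.re from hζ).le

theorem re_pos_of_mem_openCone {τ : ℝ} (hτ : 0 < τ) {ζ : ℂ} (hζ : ζ ∈ openCone τ) : 0 < ζ.re :=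
  pos_of_mul_pos_right ((abs_nonneg _).trans_lt hζ) hτ.le

theorem add_mem_openCone {τ : ℝ} {a b : ℂ} (ha : a ∈ openCone τ) (hb : b ∈ openCone τ) :
    a + b ∈ openCone τ := by
  simp only [openCone, Set.mem_ofPred_eq, Complex.add_im, Complex.add_re] at *
  linarith [abs_add_le a.im b.im]

namespace IsLyapunovTriple

variable {R M P : K →L[ℂ] K} {m c : ℝ}

variable (h : IsLyapunovTriple R M P m c)
include h

/-- After `B_η = G B_ε`, only `B_ε²` has to be absorbed. As `t ≥ 1/2`, a factor `exp(ζB_ε/2)` can be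
split off for that purpose, and the remaining exponentials are merely bounded. -/
theorem norm_approx_mul_approx_mul_exp_le {ε η : ℝ} (hε : 0 < ε) (hη : 0 < η)
    (hle : ε ≤ 2 * η) {ζ : ℂ} (hζ : ζ ∈ closedCone (slope M P c)) (hre : 0 < ζ.re) {t : ℝ}
    (ht : 1 / 2 ≤ t) (ht' : t ≤ 1) :
    ‖approx R M ε * approx R M η * (NormedSpace.exp ((t : ℂ) • ζ • approx R M ε) *
        NormedSpace.exp (((1 - t : ℝ) : ℂ) • ζ • approx R M η))‖
      ≤ 2 * (√(‖P‖ / m) / (slope M P c / 8 * ζ.re)) ^ 2 * √(‖P‖ / m) * √(‖P‖ / m) := by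
  obtain ⟨G, hG, hGη⟩ := h.norm_approx_ratio hε hη hle
  have hcone := h.closedCone_subset hζ
  have e1 : (t : ℂ) • ζ • approx R M ε = (((1 / 2 : ℝ) : ℂ) * ζ) • approx R M ε
      + (((t - 1 / 2 : ℝ) : ℂ) * ζ) • approx R M ε := by
    rw [← add_smul, smul_smul]; congr 1; push_cast; ring
  have h1 := h.norm_approx_sq_mul_exp_le hε (h.smul_mem_closedCone (t := 1 / 2) (by norm_num) hζ)
    (by rw [Complex.re_ofReal_mul]; positivity)
  have h1' : slope M P c / 4 * (((1 / 2 : ℝ) : ℂ) * ζ).re = slope M P c / 8 * ζ.re := by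
    rw [Complex.re_ofReal_mul]; ring
  rw [h1'] at h1
  have h2 := h.norm_exp_approx_le hε (h.smul_mem_closedCone (t := t - 1 / 2) (by linarith) hcone)
  have h3 := h.norm_exp_approx_le hη (h.smul_mem_closedCone (t := 1 - t) (by linarith) hcone)
  rw [(h.approx_comm ε η).eq, e1, exp_add_of_commute_clm
    (((Commute.refl (approx R M ε)).smul_left _).smul_right _), smul_smul]
  have e2 : approx R M η * approx R M ε = G * (approx R M ε * approx R M ε) := by
    rw [← mul_assoc, ← hGη]
  rw [e2]
  set B := approx R M ε
  set E₁ := NormedSpace.exp ((((1 / 2 : ℝ) : ℂ) * ζ) • B)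
  set E₂ := NormedSpace.exp ((((t - 1 / 2 : ℝ) : ℂ) * ζ) • B)
  set E₃ := NormedSpace.exp ((((1 - t : ℝ) : ℂ) * ζ) • approx R M η)
  have e3 : G * (B * B) * (E₁ * E₂ * E₃) = G * (B * B * E₁) * E₂ * E₃ := by noncomm_ring
  rw [e3]
  refine (norm_mul_le _ _).trans ?_
  gcongr
  refine (norm_mul_le _ _).trans ?_
  gcongr
  refine (norm_mul_le _ _).trans ?_
  gcongr

theorem norm_le_two_mul_re {ζ : ℂ} (hζ : ζ ∈ closedCone (slope M P c)) (hre : 0 < ζ.re) :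
    ‖ζ‖ ≤ 2 * ζ.re := by
  have h1 := Complex.norm_le_abs_re_add_abs_im ζ
  rw [abs_of_pos hre] at h1
  have h2 : |ζ.im| ≤ slope M P c * ζ.re := hζ
  nlinarith [h.slope_le]

/-- In Duhamel's formula the integrand is at most `|ζ| · ε · ‖M⁻¹‖` times a multiple of `1/(Re ζ)²`,
and `|ζ| ≤ 2 Re ζ` on the cone. The bound is linear in `ε`, hence summable along `ε = 2⁻ⁿ`. -/
theorem exists_norm_exp_approx_sub_le : ∃ C : ℝ, 0 ≤ C ∧ ∀ ε : ℝ, 0 < ε →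
    ∀ ζ ∈ closedCone (slope M P c), 0 < ζ.re →
      ‖NormedSpace.exp (ζ • approx R M ε) - NormedSpace.exp (ζ • approx R M (ε / 2))‖
        ≤ C / ζ.re * ε := by
  have hs := h.slope_pos
  set N := √(‖P‖ / m) with hN
  have hN0 : 0 ≤ N := Real.sqrt_nonneg _
  set s := slope M P c with hsdef
  refine ⟨2 * ‖Ring.inverse M‖ * (2 * (N / (s / 8)) ^ 2 * N * N), by positivity,
    fun ε hε ζ hζ hre => ?_⟩
  have hη : 0 < ε / 2 := by positivity
  set B := approx R M ε with hB
  set B' := approx R M (ε / 2) with hB'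
  have hBB' : Commute B B' := h.approx_comm ε (ε / 2)
  refine norm_exp_sub_exp_le ((hBB'.smul_left _).smul_right _) fun t ht0 ht1 => ?_
  have key : ‖B * B' * (NormedSpace.exp ((t : ℂ) • ζ • B) *
      NormedSpace.exp (((1 - t : ℝ) : ℂ) • ζ • B'))‖ ≤ 2 * (N / (s / 8 * ζ.re)) ^ 2 * N * N := by
    rcases le_total (1 / 2) t with ht | ht
    · exact h.norm_approx_mul_approx_mul_exp_le hε hη (by linarith) hζ hre ht ht1
    -- For `t ≤ 1/2` the larger share of the exponent belongs to `B'`, so the two approximations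
    -- exchange roles.
    · have h1 := h.norm_approx_mul_approx_mul_exp_le hη hε (by linarith) hζ hre (t := 1 - t)
        (by linarith) (by linarith)
      rw [sub_sub_cancel] at h1
      have h2 : Commute (NormedSpace.exp ((t : ℂ) • ζ • B))
          (NormedSpace.exp (((1 - t : ℝ) : ℂ) • ζ • B')) :=
        (((((hBB'.smul_left _).smul_left _).smul_right _).smul_right _).exp_left).exp_right
      rw [hBB'.eq, h2.eq]
      exact h1
  rw [← smul_sub, h.approx_sub_approx hε hη, smul_mul_assoc, smul_mul_assoc, mul_assoc, norm_smul,
    norm_smul, Complex.norm_real]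
  have hε2 : ‖ε / 2 - ε‖ ≤ ε := by
    rw [Real.norm_eq_abs, abs_le]; constructor <;> linarith
  have h2 := (norm_mul_le (Ring.inverse M) _).trans
    (mul_le_mul_of_nonneg_left key (norm_nonneg (Ring.inverse M)))
  calc _ ≤ (2 * ζ.re) * (ε * (‖Ring.inverse M‖ * (2 * (N / (s / 8 * ζ.re)) ^ 2 * N * N))) := by
        gcongr
        exact h.norm_le_two_mul_re hζ hre
    _ = _ := by field_simp

/-- The semigroup `exp (ζ R⁻²M)`, the limit of the exponentials of the bounded approximations. -/
def semigroup (R M : K →L[ℂ] K) (ζ : ℂ) : K →L[ℂ] K :=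
  limUnder atTop fun n : ℕ => NormedSpace.exp (ζ • approx R M ((1 / 2 : ℝ) ^ n))

theorem exists_dist_semigroup_le : ∃ C : ℝ, 0 ≤ C ∧ ∀ ζ ∈ openCone (slope M P c),
    Tendsto (fun n : ℕ => NormedSpace.exp (ζ • approx R M ((1 / 2 : ℝ) ^ n))) atTop
      (𝓝 (semigroup R M ζ)) ∧
    ∀ n : ℕ, dist (NormedSpace.exp (ζ • approx R M ((1 / 2 : ℝ) ^ n))) (semigroup R M ζ)
      ≤ C / ζ.re * (1 / 2 : ℝ) ^ n := by
  obtain ⟨C, hC, hdist⟩ := h.exists_norm_exp_approx_sub_le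
  refine ⟨2 * C, by positivity, fun ζ hζ => ?_⟩
  have hre := re_pos_of_mem_openCone h.slope_pos hζ
  have h1 : ∀ n : ℕ, dist (NormedSpace.exp (ζ • approx R M ((1 / 2 : ℝ) ^ n)))
      (NormedSpace.exp (ζ • approx R M ((1 / 2 : ℝ) ^ (n + 1)))) ≤ C / ζ.re * (1 / 2 : ℝ) ^ n := by
    intro n
    rw [dist_eq_norm]
    have := hdist ((1 / 2 : ℝ) ^ n) (by positivity) ζ (openCone_subset_closedCone _ hζ) hre
    rwa [show (1 / 2 : ℝ) ^ n / 2 = (1 / 2 : ℝ) ^ (n + 1) by ring] at this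
  have h2 := (cauchySeq_of_le_geometric _ _ (by norm_num) h1).tendsto_limUnder
  refine ⟨h2, fun n => (dist_le_of_le_geometric_of_tendsto _ _ (by norm_num) h1 h2 n).trans_eq ?_⟩
  ring

theorem tendsto_semigroup {ζ : ℂ} (hζ : ζ ∈ insert 0 (openCone (slope M P c))) :
    Tendsto (fun n : ℕ => NormedSpace.exp (ζ • approx R M ((1 / 2 : ℝ) ^ n))) atTop
      (𝓝 (semigroup R M ζ)) := by
  rcases hζ with rfl | hζ
  -- The rate `C / Re ζ` says nothing at the vertex, but there the sequence is constant.
  · refine CauchySeq.tendsto_limUnder ?_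
    simp only [zero_smul, NormedSpace.exp_zero]
    exact tendsto_const_nhds.cauchySeq
  · obtain ⟨C, -, hC⟩ := h.exists_dist_semigroup_le
    exact (hC ζ hζ).1

theorem semigroup_zero : semigroup R M 0 = 1 := by
  refine tendsto_nhds_unique (h.tendsto_semigroup (Set.mem_insert _ _)) ?_
  simp

theorem insert_openCone_subset :
    insert 0 (openCone (slope M P c)) ⊆ closedCone (2 * slope M P c) := by
  rintro ζ (rfl | hζ)
  · simp [closedCone]
  · exact h.closedCone_subset (openCone_subset_closedCone _ hζ)

theorem norm_semigroup_le {ζ : ℂ} (hζ : ζ ∈ insert 0 (openCone (slope M P c))) :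
    ‖semigroup R M ζ‖ ≤ √(‖P‖ / m) :=
  le_of_tendsto (h.tendsto_semigroup hζ).norm (Eventually.of_forall fun n =>
    h.norm_exp_approx_le (by positivity) (h.insert_openCone_subset hζ))

omit h in
theorem add_mem_insert_openCone {τ : ℝ} {a b : ℂ} (ha : a ∈ insert 0 (openCone τ))
    (hb : b ∈ insert 0 (openCone τ)) : a + b ∈ insert 0 (openCone τ) := by
  rcases ha with rfl | ha
  · simpa using hb
  rcases hb with rfl | hb
  · simpa using Or.inr ha
  · exact Or.inr (add_mem_openCone ha hb)

theorem semigroup_add {a b : ℂ} (ha : a ∈ insert 0 (openCone (slope M P c)))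
    (hb : b ∈ insert 0 (openCone (slope M P c))) :
    semigroup R M (a + b) = semigroup R M a * semigroup R M b := by
  refine tendsto_nhds_unique (h.tendsto_semigroup (add_mem_insert_openCone ha hb)) ?_
  refine ((h.tendsto_semigroup ha).mul (h.tendsto_semigroup hb)).congr fun n => ?_
  rw [add_smul, exp_add_of_commute_clm (((Commute.refl _).smul_left _).smul_right _)]

theorem commute_semigroup {ζ : ℂ} (hζ : ζ ∈ insert 0 (openCone (slope M P c)))
    {D : K →L[ℂ] K} (hR : Commute R D) (hM : Commute M D) : Commute (semigroup R M ζ) D := by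
  refine tendsto_nhds_unique ((h.tendsto_semigroup hζ).mul_const D) ?_
  refine ((h.tendsto_semigroup hζ).const_mul D).congr fun n => ?_
  exact ((((commute_approx_left hR hM _).smul_left ζ).exp_left).eq).symm

/-- The rate `C / Re w` is uniform on the neighbourhood `Re w > Re ζ / 2`. Local uniformity passes
both holomorphy and derivatives to the limit. -/
theorem tendstoLocallyUniformlyOn_semigroup :
    TendstoLocallyUniformlyOn (fun (n : ℕ) ζ => NormedSpace.exp (ζ • approx R M ((1 / 2 : ℝ) ^ n)))
      (semigroup R M) atTop (openCone (slope M P c)) := by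
  obtain ⟨C, hC0, hC⟩ := h.exists_dist_semigroup_le
  rw [Metric.tendstoLocallyUniformlyOn_iff]
  intro e he ζ hζ
  have hre := re_pos_of_mem_openCone h.slope_pos hζ
  have hlim : Tendsto (fun n : ℕ => C / (ζ.re / 2) * (1 / 2 : ℝ) ^ n) atTop (𝓝 0) := by
    simpa using (tendsto_pow_atTop_nhds_zero_of_lt_one (r := (1 / 2 : ℝ)) (by norm_num)
      (by norm_num)).const_mul (C / (ζ.re / 2))
  refine ⟨{w | ζ.re / 2 < w.re} ∩ openCone (slope M P c), ?_, ?_⟩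
  · rw [Set.inter_comm]
    refine inter_mem_nhdsWithin _ ((isOpen_lt continuous_const Complex.continuous_re).mem_nhds ?_)
    change ζ.re / 2 < ζ.re
    linarith
  · filter_upwards [hlim.eventually (gt_mem_nhds he)] with n hn w hw
    have hw1 : ζ.re / 2 < w.re := hw.1
    rw [dist_comm]
    refine ((hC w hw.2).2 n).trans_lt (lt_of_le_of_lt ?_ hn)
    gcongr

theorem differentiableOn_semigroup :
    DifferentiableOn ℂ (semigroup R M) (openCone (slope M P c)) :=
  h.tendstoLocallyUniformlyOn_semigroup.differentiableOn
    (Eventually.of_forall fun _ => (differentiable_exp_smul_const ℂ _).differentiableOn)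
    (isOpen_openCone _)

/-- The equation `S' = R⁻²MS` without the unbounded inverse: it is the limit of `(R² + ε) B_ε
exp(ζB_ε) = M exp(ζB_ε)`. -/
theorem mul_deriv_semigroup {ζ : ℂ} (hζ : ζ ∈ openCone (slope M P c)) :
    R * R * deriv (semigroup R M) ζ = M * semigroup R M ζ := by
  have hd := (h.tendstoLocallyUniformlyOn_semigroup.deriv
    (Eventually.of_forall fun _ => (differentiable_exp_smul_const ℂ _).differentiableOn)
    (isOpen_openCone _)).tendsto_at hζ
  have hε : Tendsto (fun n : ℕ => (((1 / 2 : ℝ) ^ n : ℝ) : ℂ)) atTop (𝓝 0) := by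
    have := (tendsto_pow_atTop_nhds_zero_of_lt_one (r := (1 / 2 : ℝ)) (by norm_num)
      (by norm_num))
    exact_mod_cast (Complex.continuous_ofReal.tendsto 0).comp this
  have h1 : Tendsto (fun n : ℕ => R * R + (((1 / 2 : ℝ) ^ n : ℝ) : ℂ) • (1 : K →L[ℂ] K)) atTop
      (𝓝 (R * R)) := by
    simpa using (hε.smul_const (1 : K →L[ℂ] K)).const_add (R * R)
  refine tendsto_nhds_unique (h1.mul hd) ?_
  refine ((h.tendsto_semigroup (Or.inr hζ)).const_mul M).congr fun n => ?_
  have h2 := (hasDerivAt_exp_smul_const' (𝕂 := ℂ) (approx R M ((1 / 2 : ℝ) ^ n)) ζ).deriv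
  simp only [Function.comp]
  rw [h2, ← mul_assoc, h.shift_mul_approx (by positivity)]

/-- On the range of `R²` the approximations are bounded uniformly in `ε`, since `B_ε R²x = R²(R² +
ε)⁻¹Mx` and `R²(R² + ε)⁻¹` is a contraction. -/
theorem norm_exp_approx_apply_sub_le {ε : ℝ} (hε : 0 < ε) {ζ : ℂ}
    (hζ : ζ ∈ closedCone (2 * slope M P c)) (x : K) :
    ‖NormedSpace.exp (ζ • approx R M ε) (R (R x)) - R (R x)‖
      ≤ √(‖P‖ / m) * (‖ζ‖ * (‖M‖ * ‖x‖)) := by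
  set B := approx R M ε with hB
  set y := R (R x) with hy
  have hBy : ‖B y‖ ≤ ‖M‖ * ‖x‖ := by
    have hRB : Commute R B := (commute_approx_left (Commute.refl R) h.comm_M.symm ε).symm
    have h1 : B y = R (R (Ring.inverse (R * R + (ε : ℂ) • (1 : K →L[ℂ] K)) (M x))) :=
      congrArg (fun D : K →L[ℂ] K => D x) ((hRB.mul_left hRB).eq).symm
    rw [h1]
    exact (h.norm_S_inverse_shift_le hε (M x)).trans (M.le_opNorm x)
  have hder : ∀ t : ℝ, HasDerivAt (fun s : ℝ => NormedSpace.exp ((s : ℂ) • ζ • B) y)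
      (NormedSpace.exp ((t : ℂ) • ζ • B) (ζ • B y)) t := by
    intro t
    have h1 := hasDerivAt_exp_ofReal_smul_apply (ζ • B) y t
    have h2 : Commute (ζ • B) (NormedSpace.exp ((t : ℂ) • ζ • B)) :=
      ((Commute.refl (ζ • B)).smul_right _).exp_right
    have h3 := congrArg (fun D : K →L[ℂ] K => D y) h2.eq
    convert h1 using 1
    exact h3.symm
  have := norm_image_sub_le_of_norm_deriv_le_segment_01'
    (f := fun s : ℝ => NormedSpace.exp ((s : ℂ) • ζ • B) y) (C := √(‖P‖ / m) * (‖ζ‖ * (‖M‖ * ‖x‖)))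
    (fun t _ => (hder t).hasDerivWithinAt) (fun t ht => ?_)
  · simpa using this
  · refine (ContinuousLinearMap.le_opNorm _ _).trans ?_
    rw [norm_smul, smul_smul]
    gcongr
    exact h.norm_exp_approx_le hε (h.smul_mem_closedCone ht.1 hζ)

theorem norm_semigroup_apply_sub_le {ζ : ℂ} (hζ : ζ ∈ insert 0 (openCone (slope M P c))) (x : K) :
    ‖semigroup R M ζ (R (R x)) - R (R x)‖ ≤ √(‖P‖ / m) * (‖ζ‖ * (‖M‖ * ‖x‖)) := by
  have h1 := ((ContinuousLinearMap.apply ℂ K (R (R x))).continuous.tendsto _).comp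
    (h.tendsto_semigroup hζ)
  refine le_of_tendsto ((h1.sub_const (R (R x))).norm) (Eventually.of_forall fun n => ?_)
  exact h.norm_exp_approx_apply_sub_le (by positivity) (h.insert_openCone_subset hζ) x

theorem dense_range_sq : Dense (Set.range fun x => R (R x)) := by
  have hs : (R * R : K →L[ℂ] K).IsSymmetric := fun x y => by
    change ⟪R (R x), y⟫_ℂ = ⟪x, R (R y)⟫_ℂ
    rw [h.inner_R_left, h.inner_R_left]
  have h1 := LinearMap.IsSymmetric.orthogonal_range hs
  have h2 : LinearMap.ker ((R * R : K →L[ℂ] K) : K →ₗ[ℂ] K) = ⊥ :=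
    LinearMap.ker_eq_bot.2 (h.injective_R.comp h.injective_R)
  rw [h2, ← Submodule.topologicalClosure_eq_top_iff, ← Submodule.dense_iff_topologicalClosure_eq_top]
    at h1
  exact h1

/-- Strong continuity holds with a rate on the range of `R²`, which is dense; uniform boundedness
carries it to every vector. -/
theorem tendsto_semigroup_apply (x : K) :
    Tendsto (fun ζ => semigroup R M ζ x) (𝓝[insert 0 (openCone (slope M P c))] 0) (𝓝 x) := by
  set N := √(‖P‖ / m)
  have hN : 0 ≤ N := Real.sqrt_nonneg _
  rw [Metric.tendsto_nhds]
  intro e he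
  obtain ⟨_, ⟨y, rfl⟩, hy⟩ := h.dense_range_sq.exists_dist_lt x (ε := e / (2 * (N + 1))) (by positivity)
  have hy' : (N + 1) * dist x (R (R y)) < e / 2 := by
    rw [lt_div_iff₀ (by positivity)] at hy
    linarith
  have hlim : Tendsto (fun ζ : ℂ => N * (‖ζ‖ * (‖M‖ * ‖y‖)))
      (𝓝[insert 0 (openCone (slope M P c))] 0) (𝓝 0) := by
    have : Continuous fun ζ : ℂ => N * (‖ζ‖ * (‖M‖ * ‖y‖)) := by fun_prop
    have h0 := this.tendsto 0
    simp only [norm_zero, zero_mul, mul_zero] at h0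
    exact h0.mono_left nhdsWithin_le_nhds
  filter_upwards [hlim.eventually (gt_mem_nhds (half_pos he)), self_mem_nhdsWithin] with ζ hζ hmem
  rw [dist_eq_norm] at *
  have h1 := h.norm_semigroup_apply_sub_le hmem y
  have h2 : ‖semigroup R M ζ (x - R (R y))‖ ≤ N * ‖x - R (R y)‖ :=
    (ContinuousLinearMap.le_opNorm _ _).trans (by gcongr; exact h.norm_semigroup_le hmem)
  have h3 : semigroup R M ζ x - x = semigroup R M ζ (x - R (R y))
      + (semigroup R M ζ (R (R y)) - R (R y)) - (x - R (R y)) := by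
    rw [map_sub]; abel
  rw [h3]
  calc _ ≤ ‖semigroup R M ζ (x - R (R y))‖ + ‖semigroup R M ζ (R (R y)) - R (R y)‖
        + ‖x - R (R y)‖ := (norm_sub_le _ _).trans (by gcongr; exact norm_add_le _ _)
    _ < e := by linarith

theorem ofReal_mem_insert_openCone (t : ℝ≥0) :
    ((t : ℝ) : ℂ) ∈ insert 0 (openCone (slope M P c)) := by
  rcases eq_or_ne t 0 with rfl | ht
  · simp
  · refine Or.inr ?_
    have : (0 : ℝ) < t := by positivity
    simp only [openCone, Set.mem_ofPred_eq, Complex.ofReal_im, Complex.ofReal_re, abs_zero]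
    exact mul_pos h.slope_pos this

theorem tendsto_semigroup_ofReal (x : K) :
    Tendsto (fun t : ℝ≥0 => semigroup R M ((t : ℝ) : ℂ) x) (𝓝 0) (𝓝 x) := by
  refine (h.tendsto_semigroup_apply x).comp (tendsto_nhdsWithin_iff.2 ⟨?_, ?_⟩)
  · have : Continuous fun t : ℝ≥0 => ((t : ℝ) : ℂ) := by fun_prop
    simpa using this.tendsto 0
  · exact Eventually.of_forall h.ofReal_mem_insert_openCone

/-- For `t > 0` the orbit has derivative `S(t)y`, as one sees after applying the injective `R²`.
This derivative tends to `y` as `t → 0`, so the right derivative at 0 exists and equals `y`. -/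
theorem tendsto_slope_semigroup {x y : K} (hxy : R (R y) = M x) :
    Tendsto (fun t : ℝ≥0 => ((t : ℝ) : ℂ)⁻¹ • (semigroup R M ((t : ℝ) : ℂ) x - x)) (𝓝[>] 0)
      (𝓝 y) := by
  have hmem : ∀ t : ℝ, 0 < t → (t : ℂ) ∈ openCone (slope M P c) := fun t ht => by
    simp only [openCone, Set.mem_ofPred_eq, Complex.ofReal_im, Complex.ofReal_re, abs_zero]
    exact mul_pos h.slope_pos ht
  set f : ℝ → K := fun t => semigroup R M (t : ℂ) x with hf
  have hder : ∀ t : ℝ, 0 < t → HasDerivAt f (semigroup R M (t : ℂ) y) t := by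
    intro t ht
    have h1 := ((h.differentiableOn_semigroup).differentiableAt
      ((isOpen_openCone _).mem_nhds (hmem t ht))).hasDerivAt
    have h2 := (h1.clm_apply (hasDerivAt_const (t : ℂ) x)).scomp t Complex.ofRealCLM.hasDerivAt
    simp only [Complex.ofRealCLM_apply, Complex.ofReal_one, one_smul, map_zero, add_zero] at h2
    convert! h2 using 1
    refine h.injective_R (h.injective_R ?_)
    have hR := h.commute_semigroup (Or.inr (hmem t ht)) (Commute.refl R) h.comm_M.symm
    have hM := h.commute_semigroup (Or.inr (hmem t ht)) h.comm_M (Commute.refl M)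
    have e1 := congrArg (fun D : K →L[ℂ] K => D x) (h.mul_deriv_semigroup (hmem t ht))
    have e2 := congrArg (fun D : K →L[ℂ] K => D x) hM.eq
    have e3 := congrArg (fun D : K →L[ℂ] K => D y) (hR.mul_right hR).eq
    change semigroup R M t (R (R y)) = R (R (semigroup R M t y)) at e3
    change semigroup R M t (M x) = M (semigroup R M t x) at e2
    change R (R (deriv (semigroup R M) t x)) = M (semigroup R M t x) at e1
    rw [e1, ← e2, ← e3, hxy]
  have hin : ∀ᶠ t : ℝ in 𝓝[>] 0, (t : ℂ) ∈ insert 0 (openCone (slope M P c)) := by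
    filter_upwards [self_mem_nhdsWithin] with t ht using Or.inr (hmem t ht)
  have hlim : ∀ z : K, Tendsto (fun t : ℝ => semigroup R M (t : ℂ) z) (𝓝[>] 0) (𝓝 z) := by
    intro z
    refine (h.tendsto_semigroup_apply z).comp (tendsto_nhdsWithin_iff.2 ⟨?_, hin⟩)
    exact (by simpa using Complex.continuous_ofReal.tendsto 0 :
      Tendsto (fun t : ℝ => (t : ℂ)) (𝓝 0) (𝓝 0)).mono_left nhdsWithin_le_nhds
  have hf0 : f 0 = x := by simp [hf, h.semigroup_zero]
  have hright : HasDerivWithinAt f y (Set.Ici 0) 0 := by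
    refine hasDerivWithinAt_Ici_of_tendsto_deriv (s := Set.Ioi 0)
      (fun t ht => (hder t ht).differentiableAt.differentiableWithinAt) ?_ self_mem_nhdsWithin ?_
    · rw [ContinuousWithinAt, hf0]
      exact hlim x
    · refine (hlim y).congr' ?_
      filter_upwards [self_mem_nhdsWithin] with t ht using ((hder t ht).deriv).symm
  have h3 := (hasDerivWithinAt_iff_tendsto_slope' (s := Set.Ioi 0) (by simp)).1 hright.Ioi_of_Ici
  have h4 : Tendsto (fun t : ℝ≥0 => (t : ℝ)) (𝓝[>] 0) (𝓝[>] 0) := by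
    refine tendsto_nhdsWithin_iff.2 ⟨?_, ?_⟩
    · exact (by simpa using NNReal.continuous_coe.tendsto 0 :
        Tendsto (fun t : ℝ≥0 => (t : ℝ)) (𝓝 0) (𝓝 0)).mono_left nhdsWithin_le_nhds
    · filter_upwards [self_mem_nhdsWithin] with t ht
      exact NNReal.coe_pos.2 ht
  refine (h3.comp h4).congr fun t => ?_
  simp only [Function.comp, slope_def_module, sub_zero, hf0]
  simp only [hf]
  rw [← Complex.ofReal_inv, Complex.coe_smul]

theorem graph_iff_tendsto (x y : K) : R (R y) = M x ↔
    Tendsto (fun t : ℝ≥0 => ((t : ℝ) : ℂ)⁻¹ • (semigroup R M ((t : ℝ) : ℂ) x - x)) (𝓝[>] 0)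
      (𝓝 y) := by
  refine ⟨h.tendsto_slope_semigroup, fun hy => ?_⟩
  have hM : M (R (R x)) = R (R (M x)) :=
    congrArg (fun D : K →L[ℂ] K => D x) ((h.comm_M.symm.mul_right h.comm_M.symm).eq)
  -- For the converse, `R²x` always belongs to the domain, with image `Mx`. Applying `R²` to the
  -- difference quotients at `x` gives those at `R²x`, so the limits `R²y` and `Mx` agree.
  have h1 := h.tendsto_slope_semigroup (x := R (R x)) (y := M x) hM.symm
  have h2 := ((R * R : K →L[ℂ] K).continuous.tendsto y).comp hy
  have hne : (𝓝[>] (0 : ℝ≥0)).NeBot := inferInstance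
  refine tendsto_nhds_unique h2 (h1.congr fun t => ?_)
  have hR := h.commute_semigroup (h.ofReal_mem_insert_openCone t) (Commute.refl R) h.comm_M.symm
  have e3 : semigroup R M ((t : ℝ) : ℂ) (R (R x)) = R (R (semigroup R M ((t : ℝ) : ℂ) x)) :=
    congrArg (fun D : K →L[ℂ] K => D x) (hR.mul_right hR).eq
  simp [e3]

/-- On the closed right half plane `μR² - M` is boundedly invertible, uniformly in `μ`. -/
theorem exists_resolvent : ∃ C : ℝ, 0 ≤ C ∧ ∀ μ : ℂ, 0 ≤ μ.re → ∃ J : K →L[ℂ] K,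
    ‖J‖ ≤ C ∧ J * (μ • (R * R) - M) = 1 ∧ (μ • (R * R) - M) * J = 1 := by
  have hc := h.c_pos
  refine ⟨‖P‖ / c, by positivity, fun μ hμ => ?_⟩
  set D := μ • (R * R) - M with hD
  -- The `μ`-part equals `Re μ ⟪PRx, Rx⟫ ≥ 0`: the inner product is real, so `Im μ` drops out and
  -- the bound is independent of `μ`.
  have hlow : ∀ x, c * ‖x‖ ^ 2 ≤ (⟪P (D x), x⟫_ℂ).re := by
    intro x
    have e1 : P (D x) = μ • R (P (R x)) - P (M x) := by
      have : P (R (R x)) = R (P (R x)) :=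
        congrArg (fun D : K →L[ℂ] K => D (R x)) h.comm_P.symm.eq
      simp [hD, this]
    have e2 : (⟪P (R x), R x⟫_ℂ).im = 0 := by
      have h3 : ⟪P (R x), R x⟫_ℂ = ⟪R x, P (R x)⟫_ℂ := h.selfAdjoint_P.isSymmetric _ _
      rw [← inner_conj_symm (R x)] at h3
      exact Complex.conj_eq_iff_im.1 h3.symm
    have e3 : 0 ≤ (⟪P (R x), R x⟫_ℂ).re :=
      le_trans (mul_nonneg h.m_pos.le (sq_nonneg _)) (h.lower (R x))
    rw [e1, inner_sub_left, inner_smul_left, h.inner_R_left, Complex.sub_re, Complex.mul_re, e2,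
      Complex.conj_re]
    nlinarith [h.dissipative x, mul_nonneg hμ e3]
  have hP : IsUnit P := isUnit_of_re_inner_ge h.m_pos fun x => (h.lower x).trans (le_abs_self _)
  have hPD : IsUnit (P * D) :=
    isUnit_of_re_inner_ge hc fun x => (hlow x).trans (le_abs_self (⟪P (D x), x⟫_ℂ).re)
  have hDu : IsUnit D := by
    obtain ⟨u, rfl⟩ := hP
    exact (Units.isUnit_units_mul u D).1 hPD
  refine ⟨Ring.inverse D, ?_, Ring.inverse_mul_cancel _ hDu, Ring.mul_inverse_cancel _ hDu⟩
  refine ContinuousLinearMap.opNorm_le_bound _ (by positivity) fun y => ?_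
  set x := Ring.inverse D y with hx
  have hy : D x = y := by
    have := congrArg (fun D : K →L[ℂ] K => D y) (Ring.mul_inverse_cancel _ hDu)
    simpa using this
  have h1 := (hlow x).trans ((Complex.re_le_norm _).trans (norm_inner_le_norm _ _))
  rw [hy] at h1
  have h2 := P.le_opNorm y
  rw [div_mul_eq_mul_div, le_div_iff₀ hc]
  rcases (norm_nonneg x).eq_or_lt with h0 | h0
  · rw [← h0]; simp; positivity
  · have : ‖x‖ * c * ‖x‖ ≤ ‖P‖ * ‖y‖ * ‖x‖ := by nlinarith
    exact le_of_mul_le_mul_right this h0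

end IsLyapunovTriple

end LyapunovSemigroup

/-! ### The system in energy coordinates and its strict Lyapunov form. -/

section EnergySystem

set_option linter.unusedSectionVars false

variable {H : Type*} [NormedAddCommGroup H] [InnerProductSpace ℂ H] [CompleteSpace H]

/-- The Hilbert space of the vectors `(Au, A^{1/2}v, A^{1/2}w, z)`. -/
abbrev EnergySpace (H : Type*) [NormedAddCommGroup H] : Type _ := PiLp 2 fun _ : Fin 4 => H

/-- The operator on the energy space with prescribed components. -/
def energyMap (f : Fin 4 → EnergySpace H →L[ℂ] H) : EnergySpace H →L[ℂ] EnergySpace H :=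
  ((PiLp.continuousLinearEquiv 2 ℂ fun _ : Fin 4 => H).symm :
    (Fin 4 → H) →L[ℂ] EnergySpace H).comp (ContinuousLinearMap.pi f)

theorem energyMap_apply (f : Fin 4 → EnergySpace H →L[ℂ] H) (x : EnergySpace H) (i : Fin 4) :
    energyMap f x i = f i x := rfl

/-- The coordinate projections of the energy space. -/
def energyProj (i : Fin 4) : EnergySpace H →L[ℂ] H := PiLp.proj 2 (fun _ : Fin 4 => H) i

@[simp] theorem energyProj_apply (i : Fin 4) (x : EnergySpace H) : energyProj i x = x i := rfl

/-- The diagonal action of an operator on the energy space. -/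
def energyDiag (D : H →L[ℂ] H) : EnergySpace H →L[ℂ] EnergySpace H :=
  energyMap fun i => D.comp (energyProj i)

@[simp] theorem energyDiag_apply (D : H →L[ℂ] H) (x : EnergySpace H) (i : Fin 4) :
    energyDiag D x i = D (x i) := rfl

/-- The operator `κ + A⁻¹`, with `A⁻¹ = R⁴`. -/
def massOp (c : Coefficients) (R : H →L[ℂ] H) : H →L[ℂ] H := R * R * (R * R) + (c.κ : ℂ) • 1

/-- The bounded factor `M` of the generator `A^{1/2}M` in the coordinates of the energy space. -/
def systemOp (c : Coefficients) (R : H →L[ℂ] H) : EnergySpace H →L[ℂ] EnergySpace H :=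
  energyMap ![energyProj 2, energyProj 3,
    -(Ring.inverse (massOp c R)).comp ((c.α : ℂ) • energyProj 0 + (c.γ : ℂ) • energyProj 3),
    -(c.α : ℂ) • energyProj 1 + (c.γ : ℂ) • energyProj 2 - (c.δ : ℂ) • energyProj 3]

theorem systemOp_zero (c : Coefficients) (R : H →L[ℂ] H) (x : EnergySpace H) :
    systemOp c R x 0 = x 2 := rfl
theorem systemOp_one (c : Coefficients) (R : H →L[ℂ] H) (x : EnergySpace H) :
    systemOp c R x 1 = x 3 := rfl
theorem systemOp_two (c : Coefficients) (R : H →L[ℂ] H) (x : EnergySpace H) :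
    systemOp c R x 2 = -Ring.inverse (massOp c R) ((c.α : ℂ) • x 0 + (c.γ : ℂ) • x 3) := rfl
theorem systemOp_three (c : Coefficients) (R : H →L[ℂ] H) (x : EnergySpace H) :
    systemOp c R x 3 = -(c.α : ℂ) • x 1 + (c.γ : ℂ) • x 2 - (c.δ : ℂ) • x 3 := rfl

/-- The energy form `α‖u‖² + α‖v‖² + ⟪Gw, w⟫ + ‖z‖²`. -/
def energyOp (c : Coefficients) (R : H →L[ℂ] H) : EnergySpace H →L[ℂ] EnergySpace H :=
  energyMap ![(c.α : ℂ) • energyProj 0, (c.α : ℂ) • energyProj 1,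
    (massOp c R).comp (energyProj 2), energyProj 3]

/-- The correction `2 Re (⟪v, z⟫ - (γ/α)⟪z, w⟫ - 2γ⟪v, u⟫ + k⟪u, Gw⟫)` of the energy. -/
def crossOp (c : Coefficients) (R : H →L[ℂ] H) (k : ℝ) : EnergySpace H →L[ℂ] EnergySpace H :=
  energyMap ![((-2 * c.γ : ℝ) : ℂ) • energyProj 1 + (k : ℂ) • (massOp c R).comp (energyProj 2),
    energyProj 3 + ((-2 * c.γ : ℝ) : ℂ) • energyProj 0,
    ((-c.γ / c.α : ℝ) : ℂ) • energyProj 3 + (k : ℂ) • (massOp c R).comp (energyProj 0),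
    energyProj 1 + ((-c.γ / c.α : ℝ) : ℂ) • energyProj 2]

theorem energy_inner (x y : EnergySpace H) :
    ⟪x, y⟫_ℂ = ⟪x 0, y 0⟫_ℂ + ⟪x 1, y 1⟫_ℂ + ⟪x 2, y 2⟫_ℂ + ⟪x 3, y 3⟫_ℂ := by
  rw [PiLp.inner_apply, Fin.sum_univ_four]

theorem energy_norm_sq (x : EnergySpace H) :
    ‖x‖ ^ 2 = ‖x 0‖ ^ 2 + ‖x 1‖ ^ 2 + ‖x 2‖ ^ 2 + ‖x 3‖ ^ 2 := by
  rw [PiLp.norm_sq_eq_of_L2, Fin.sum_univ_four]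

theorem energy_ext {x y : EnergySpace H} (h0 : x 0 = y 0) (h1 : x 1 = y 1) (h2 : x 2 = y 2)
    (h3 : x 3 = y 3) : x = y := by
  ext i
  fin_cases i <;> assumption

variable {c : Coefficients} {R : H →L[ℂ] H}

theorem massOp_symm (hR : IsSelfAdjoint R) (x y : H) :
    ⟪massOp c R x, y⟫_ℂ = ⟪x, massOp c R y⟫_ℂ := by
  have h : ∀ x y, ⟪R x, y⟫_ℂ = ⟪x, R y⟫_ℂ := hR.isSymmetric
  simp [massOp, h]

theorem re_inner_massOp (hR : IsSelfAdjoint R) (x : H) :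
    c.κ * ‖x‖ ^ 2 ≤ (⟪massOp c R x, x⟫_ℂ).re := by
  have h : ∀ x y, ⟪R x, y⟫_ℂ = ⟪x, R y⟫_ℂ := hR.isSymmetric
  have h1 : ⟪R (R (R (R x))), x⟫_ℂ = ((‖R (R x)‖ ^ 2 : ℝ) : ℂ) := by
    rw [h, h, inner_self_eq_norm_sq_to_K]; norm_cast
  have h2 : ⟪x, x⟫_ℂ = ((‖x‖ ^ 2 : ℝ) : ℂ) := by
    rw [inner_self_eq_norm_sq_to_K]; norm_cast
  have h3 : massOp c R x = R (R (R (R x))) + (c.κ : ℂ) • x := rfl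
  rw [h3, inner_add_left, inner_smul_left, h1, h2, Complex.conj_ofReal, Complex.add_re,
    Complex.ofReal_re, Complex.re_ofReal_mul, Complex.ofReal_re]
  nlinarith [sq_nonneg ‖R (R x)‖]

theorem isUnit_massOp (hR : IsSelfAdjoint R) : IsUnit (massOp c R) :=
  isUnit_of_re_inner_ge c.κ_pos fun x => (re_inner_massOp hR x).trans (le_abs_self _)

theorem massOp_inverse_apply (hR : IsSelfAdjoint R) (x : H) :
    massOp c R (Ring.inverse (massOp c R) x) = x := by
  have := congrArg (fun D : H →L[ℂ] H => D x)
    (Ring.mul_inverse_cancel _ (isUnit_massOp (c := c) hR))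
  simpa using this

theorem commute_massOp : Commute (massOp c R) R := by
  refine Commute.add_left ?_ ((Commute.one_left R).smul_left _)
  exact ((Commute.refl R).mul_left (Commute.refl R)).mul_left
    ((Commute.refl R).mul_left (Commute.refl R))

theorem isSelfAdjoint_energyDiag (hR : IsSelfAdjoint R) : IsSelfAdjoint (energyDiag R) := by
  rw [ContinuousLinearMap.isSelfAdjoint_iff_isSymmetric]
  intro x y
  have h : ∀ x y, ⟪R x, y⟫_ℂ = ⟪x, R y⟫_ℂ := hR.isSymmetric
  change ⟪energyDiag R x, y⟫_ℂ = ⟪x, energyDiag R y⟫_ℂ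
  simp [energy_inner, h]

theorem isSelfAdjoint_energyOp (hR : IsSelfAdjoint R) : IsSelfAdjoint (energyOp c R) := by
  rw [ContinuousLinearMap.isSelfAdjoint_iff_isSymmetric]
  intro x y
  change ⟪energyOp c R x, y⟫_ℂ = ⟪x, energyOp c R y⟫_ℂ
  simp [energy_inner, energyOp, energyMap_apply, massOp_symm hR]

theorem isSelfAdjoint_crossOp (hR : IsSelfAdjoint R) (k : ℝ) :
    IsSelfAdjoint (crossOp c R k) := by
  rw [ContinuousLinearMap.isSelfAdjoint_iff_isSymmetric]
  intro x y
  change ⟪crossOp c R k x, y⟫_ℂ = ⟪x, crossOp c R k y⟫_ℂ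
  simp only [energy_inner, crossOp, energyMap_apply, Matrix.cons_val_zero, Matrix.cons_val_one,
    Matrix.cons_val, add_apply, smul_apply, ContinuousLinearMap.comp_apply,
    energyProj_apply, inner_add_left, inner_add_right, inner_smul_left, inner_smul_right,
    massOp_symm hR, Complex.conj_ofReal]
  ring

theorem commute_massOp_apply (x : H) : massOp c R (R x) = R (massOp c R x) :=
  congrArg (fun D : H →L[ℂ] H => D x) (commute_massOp (c := c) (R := R)).eq

theorem commute_massOp_inverse_apply (x : H) :
    Ring.inverse (massOp c R) (R x) = R (Ring.inverse (massOp c R) x) :=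
  congrArg (fun D : H →L[ℂ] H => D x) (commute_massOp (c := c) (R := R)).ringInverse_left'.eq

theorem commute_energyDiag_systemOp : Commute (energyDiag R) (systemOp c R) := by
  refine ContinuousLinearMap.ext fun x => energy_ext ?_ ?_ ?_ ?_
  · rfl
  · rfl
  · change R (systemOp c R x 2) = systemOp c R (energyDiag R x) 2
    simp only [systemOp_two, energyDiag_apply]
    simp only [map_neg, map_add, map_smul, commute_massOp_inverse_apply]
  · change R (systemOp c R x 3) = systemOp c R (energyDiag R x) 3
    simp only [systemOp_three, energyDiag_apply]
    simp only [map_add, map_sub, map_smul]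

theorem commute_energyDiag_energyOp : Commute (energyDiag R) (energyOp c R) := by
  refine ContinuousLinearMap.ext fun x => energy_ext ?_ ?_ ?_ ?_
  · exact map_smul R _ _
  · exact map_smul R _ _
  · exact (commute_massOp_apply _).symm
  · rfl

theorem crossOp_zero (k : ℝ) (x : EnergySpace H) : crossOp c R k x 0 =
    ((-2 * c.γ : ℝ) : ℂ) • x 1 + (k : ℂ) • massOp c R (x 2) := rfl
theorem crossOp_one (k : ℝ) (x : EnergySpace H) : crossOp c R k x 1 =
    x 3 + ((-2 * c.γ : ℝ) : ℂ) • x 0 := rfl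
theorem crossOp_two (k : ℝ) (x : EnergySpace H) : crossOp c R k x 2 =
    ((-c.γ / c.α : ℝ) : ℂ) • x 3 + (k : ℂ) • massOp c R (x 0) := rfl
theorem crossOp_three (k : ℝ) (x : EnergySpace H) : crossOp c R k x 3 =
    x 1 + ((-c.γ / c.α : ℝ) : ℂ) • x 2 := rfl

theorem commute_energyDiag_crossOp (k : ℝ) : Commute (energyDiag R) (crossOp c R k) := by
  refine ContinuousLinearMap.ext fun x => energy_ext ?_ ?_ ?_ ?_
  · change R (crossOp c R k x 0) = crossOp c R k (energyDiag R x) 0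
    simp only [crossOp_zero, energyDiag_apply]
    simp only [map_add, map_smul, commute_massOp_apply]
  · change R (crossOp c R k x 1) = crossOp c R k (energyDiag R x) 1
    simp only [crossOp_one, energyDiag_apply]
    simp only [map_add, map_smul]
  · change R (crossOp c R k x 2) = crossOp c R k (energyDiag R x) 2
    simp only [crossOp_two, energyDiag_apply]
    simp only [map_add, map_smul, commute_massOp_apply]
  · change R (crossOp c R k x 3) = crossOp c R k (energyDiag R x) 3
    simp only [crossOp_three, energyDiag_apply]
    simp only [map_add, map_smul]

theorem re_inner_energyOp (hR : IsSelfAdjoint R) (x : EnergySpace H) :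
    min c.α (min c.κ 1) * ‖x‖ ^ 2 ≤ (⟪energyOp c R x, x⟫_ℂ).re := by
  have h2 : ∀ x : H, ⟪x, x⟫_ℂ = ((‖x‖ ^ 2 : ℝ) : ℂ) := fun x => by
    rw [inner_self_eq_norm_sq_to_K]; norm_cast
  have h : ⟪energyOp c R x, x⟫_ℂ = ⟪(c.α : ℂ) • x 0, x 0⟫_ℂ + ⟪(c.α : ℂ) • x 1, x 1⟫_ℂ
      + ⟪massOp c R (x 2), x 2⟫_ℂ + ⟪x 3, x 3⟫_ℂ := energy_inner _ _
  rw [h, energy_norm_sq]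
  simp only [inner_smul_left, Complex.conj_ofReal, Complex.add_re, Complex.re_ofReal_mul, h2,
    Complex.ofReal_re]
  have h3 := re_inner_massOp (c := c) hR (x 2)
  have a1 : min c.α (min c.κ 1) ≤ c.α := min_le_left _ _
  have a2 : min c.α (min c.κ 1) ≤ c.κ := (min_le_right _ _).trans (min_le_left _ _)
  have a3 : min c.α (min c.κ 1) ≤ 1 := (min_le_right _ _).trans (min_le_right _ _)
  nlinarith [mul_le_mul_of_nonneg_right a1 (sq_nonneg ‖x 0‖),
    mul_le_mul_of_nonneg_right a1 (sq_nonneg ‖x 1‖),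
    mul_le_mul_of_nonneg_right a2 (sq_nonneg ‖x 2‖),
    mul_le_mul_of_nonneg_right a3 (sq_nonneg ‖x 3‖)]

theorem re_inner_comm (a b : H) : (⟪a, b⟫_ℂ).re = (⟪b, a⟫_ℂ).re := by
  rw [← inner_conj_symm, Complex.conj_re]

/-- The energy identity: only the damping of the `z`-component dissipates energy. -/
theorem re_inner_energyOp_systemOp (hR : IsSelfAdjoint R) (x : EnergySpace H) :
    (⟪energyOp c R (systemOp c R x), x⟫_ℂ).re = -c.δ * ‖x 3‖ ^ 2 := by
  have h2 : ∀ x : H, ⟪x, x⟫_ℂ = ((‖x‖ ^ 2 : ℝ) : ℂ) := fun x => by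
    rw [inner_self_eq_norm_sq_to_K]; norm_cast
  have h : ⟪energyOp c R (systemOp c R x), x⟫_ℂ
      = ⟪(c.α : ℂ) • systemOp c R x 0, x 0⟫_ℂ + ⟪(c.α : ℂ) • systemOp c R x 1, x 1⟫_ℂ
      + ⟪massOp c R (systemOp c R x 2), x 2⟫_ℂ + ⟪systemOp c R x 3, x 3⟫_ℂ := energy_inner _ _
  rw [h, systemOp_zero, systemOp_one, systemOp_two, systemOp_three, map_neg,
    massOp_inverse_apply hR]
  simp only [inner_smul_left, inner_add_left, inner_sub_left, inner_neg_left, Complex.conj_ofReal,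
    Complex.add_re, Complex.sub_re, Complex.neg_re, Complex.re_ofReal_mul, h2, neg_smul,
    Complex.ofReal_re]
  rw [re_inner_comm (x 2) (x 0), re_inner_comm (x 3) (x 1), re_inner_comm (x 3) (x 2)]
  ring

/-- The correction of the energy dissipates all components, up to terms in `z`. -/
theorem exists_re_inner_crossOp_systemOp_le (c : Coefficients) (hR : IsSelfAdjoint R) :
    ∃ k a b : ℝ, 0 < a ∧ 0 ≤ b ∧ ∀ x : EnergySpace H,
      (⟪crossOp c R k (systemOp c R x), x⟫_ℂ).re ≤
        -a * (‖x 0‖ ^ 2 + ‖x 1‖ ^ 2 + ‖x 2‖ ^ 2)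
          + b * ‖x 3‖ * (‖x 0‖ + ‖x 1‖ + ‖x 2‖ + ‖x 3‖) := by
  have hα := c.α_pos
  have hδ := c.δ_pos
  have hγ : 0 < c.γ ^ 2 := by have := c.γ_ne_zero; positivity
  set g := ‖massOp c R‖ with hg
  have hg0 : 0 ≤ g := norm_nonneg _
  set Q := Ring.inverse (massOp c R) with hQ
  -- The term `k⟪u, Gw⟫` damps `u` at the price of `k⟪Gw, w⟫`; this `k` spends at most half of the
  -- available damping `(γ²/α)‖w‖²`.
  set k := c.γ ^ 2 / (2 * c.α * (g + 1)) with hk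
  have hk0 : 0 < k := by positivity
  have hkg : k * g ≤ c.γ ^ 2 / (2 * c.α) := by
    have : k * (g + 1) = c.γ ^ 2 / (2 * c.α) := by rw [hk]; field_simp
    nlinarith
  set a := min c.α (min (c.γ ^ 2 / (2 * c.α)) (k * c.α)) with ha
  have ha1 : a ≤ c.α := min_le_left _ _
  have ha2 : a ≤ c.γ ^ 2 / (2 * c.α) := (min_le_right _ _).trans (min_le_left _ _)
  have ha3 : a ≤ k * c.α := (min_le_right _ _).trans (min_le_right _ _)
  set b1 := |2 * c.γ| + k * |c.γ| + |c.γ| * ‖Q‖ with hb1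
  set b2 := c.γ ^ 2 / c.α * ‖Q‖ + 1 with hb2
  set b3 := |c.γ / c.α| * c.δ with hb3
  have n1 : 0 ≤ b1 := by positivity
  have n2 : 0 ≤ b2 := by positivity
  have n3 : 0 ≤ b3 := by positivity
  refine ⟨k, a, b1 + c.δ + b3 + b2, by positivity, by positivity, fun x => ?_⟩
  have h2 : ∀ x : H, ⟪x, x⟫_ℂ = ((‖x‖ ^ 2 : ℝ) : ℂ) := fun x => by
    rw [inner_self_eq_norm_sq_to_K]; norm_cast
  have h : ⟪crossOp c R k (systemOp c R x), x⟫_ℂ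
      = ⟪((-2 * c.γ : ℝ) : ℂ) • systemOp c R x 1 + (k : ℂ) • massOp c R (systemOp c R x 2), x 0⟫_ℂ
      + ⟪systemOp c R x 3 + ((-2 * c.γ : ℝ) : ℂ) • systemOp c R x 0, x 1⟫_ℂ
      + ⟪((-c.γ / c.α : ℝ) : ℂ) • systemOp c R x 3 + (k : ℂ) • massOp c R (systemOp c R x 0), x 2⟫_ℂ
      + ⟪systemOp c R x 1 + ((-c.γ / c.α : ℝ) : ℂ) • systemOp c R x 2, x 3⟫_ℂ := energy_inner _ _
  rw [h, systemOp_zero, systemOp_one, systemOp_two, systemOp_three, map_neg,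
    massOp_inverse_apply hR, ← hQ]
  simp only [inner_smul_left, inner_add_left, inner_sub_left, inner_neg_left, Complex.conj_ofReal,
    Complex.add_re, Complex.sub_re, Complex.neg_re, Complex.re_ofReal_mul, h2, neg_smul, map_add,
    map_smul, Complex.ofReal_re, smul_add, smul_sub, smul_neg]
  have B : ∀ p q : H, |(⟪p, q⟫_ℂ).re| ≤ ‖p‖ * ‖q‖ := fun p q =>
    (Complex.abs_re_le_norm _).trans (norm_inner_le_norm _ _)
  set u := x 0
  set v := x 1
  set w := x 2
  set z := x 3
  have t1 : ∀ r : ℝ, r * (⟪z, u⟫_ℂ).re ≤ |r| * (‖z‖ * ‖u‖) := fun r => by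
    refine (le_abs_self _).trans ?_
    rw [abs_mul]; gcongr; exact B z u
  have t2 : (⟪massOp c R w, w⟫_ℂ).re ≤ g * ‖w‖ ^ 2 := by
    refine (le_abs_self _).trans ((B _ _).trans ?_)
    rw [sq, ← mul_assoc]
    gcongr
    exact (massOp c R).le_opNorm w
  have t3 : -(⟪z, v⟫_ℂ).re ≤ ‖z‖ * ‖v‖ := (neg_le_abs _).trans (B z v)
  have t4 : c.γ / c.α * (⟪z, w⟫_ℂ).re ≤ |c.γ / c.α| * (‖z‖ * ‖w‖) := by
    refine (le_abs_self _).trans ?_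
    rw [abs_mul]; gcongr; exact B z w
  have t5 : c.γ * (⟪Q u, z⟫_ℂ).re ≤ |c.γ| * (‖Q‖ * ‖u‖ * ‖z‖) := by
    refine (le_abs_self _).trans ?_
    rw [abs_mul]; gcongr
    refine (B _ _).trans ?_
    gcongr
    exact Q.le_opNorm u
  have t6 : (⟪Q z, z⟫_ℂ).re ≤ ‖Q‖ * ‖z‖ * ‖z‖ := by
    refine (le_abs_self _).trans ((B _ _).trans ?_)
    gcongr
    exact Q.le_opNorm z
  rw [re_inner_comm w v]
  generalize (⟪v, w⟫_ℂ).re = vw at *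
  generalize (⟪z, u⟫_ℂ).re = zu at *
  generalize (⟪z, v⟫_ℂ).re = zv at *
  generalize (⟪z, w⟫_ℂ).re = zw at *
  generalize (⟪Q u, z⟫_ℂ).re = Qu at *
  generalize (⟪Q z, z⟫_ℂ).re = Qz at *
  generalize (⟪massOp c R w, w⟫_ℂ).re = Gw at *
  have hk2 : k * Gw ≤ c.γ ^ 2 / (2 * c.α) * ‖w‖ ^ 2 :=
    (mul_le_mul_of_nonneg_left t2 hk0.le).trans (by rw [← mul_assoc]; gcongr)
  have hd : c.γ ^ 2 / c.α = 2 * (c.γ ^ 2 / (2 * c.α)) := by field_simp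
  have s0 : (-2 * c.γ) * zu + (-(k * c.γ)) * zu ≤ (|2 * c.γ| + k * |c.γ|) * (‖z‖ * ‖u‖) := by
    have e1 := t1 (-2 * c.γ)
    have e2 := t1 (-(k * c.γ))
    rw [show -2 * c.γ = -(2 * c.γ) by ring, abs_neg] at e1
    rw [abs_neg, abs_mul, abs_of_pos hk0] at e2
    linarith
  have s6 : c.γ ^ 2 / c.α * Qz ≤ c.γ ^ 2 / c.α * (‖Q‖ * ‖z‖ * ‖z‖) := by gcongr
  have s4 := mul_le_mul_of_nonneg_left t4 hδ.le
  have s3 := mul_le_mul_of_nonneg_left t3 hδ.le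
  have u0 := norm_nonneg u
  have v0 := norm_nonneg v
  have w0 := norm_nonneg w
  have z0 := norm_nonneg z
  have r1 := mul_le_mul_of_nonneg_right ha1 (sq_nonneg ‖v‖)
  have r2 := mul_le_mul_of_nonneg_right ha2 (sq_nonneg ‖w‖)
  have r3 := mul_le_mul_of_nonneg_right ha3 (sq_nonneg ‖u‖)
  have hS : 0 ≤ ‖z‖ * (c.δ * (‖u‖ + ‖w‖ + ‖z‖) + b1 * (‖v‖ + ‖w‖ + ‖z‖)
      + b3 * (‖u‖ + ‖v‖ + ‖z‖) + b2 * (‖u‖ + ‖v‖ + ‖w‖)) := by positivity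
  -- Along the flow `⟪v, z⟫` yields `-α‖v‖²`, `-(γ/α)⟪z, w⟫` yields `-(γ²/α)‖w‖²`, and `k⟪u, Gw⟫`
  -- yields `-kα‖u‖²`. The first two also produce `γ Re⟪v, w⟫` each, and `-2γ⟪v, u⟫` is there to
  -- cancel their sum. All other terms contain `z`, except `k⟪Gw, w⟫`.
  calc _ = -(k * c.α * ‖u‖ ^ 2) - c.α * ‖v‖ ^ 2 - c.γ ^ 2 / c.α * ‖w‖ ^ 2 + k * Gw
        + ((-2 * c.γ) * zu + (-(k * c.γ)) * zu) + c.δ * (-zv) + c.δ * (c.γ / c.α * zw)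
        + ‖z‖ ^ 2 + c.γ * Qu + c.γ ^ 2 / c.α * Qz := by field_simp; ring
    _ ≤ -a * (‖u‖ ^ 2 + ‖v‖ ^ 2 + ‖w‖ ^ 2) + b1 * (‖z‖ * ‖u‖) + c.δ * (‖z‖ * ‖v‖)
        + b3 * (‖z‖ * ‖w‖) + b2 * (‖z‖ * ‖z‖) := by
      rw [hd] at s6 hb2 ⊢
      rw [hb1, hb2, hb3]
      linarith
    _ ≤ _ := by linarith

/-- The system operator admits a strict Lyapunov functional. -/
theorem exists_isLyapunovTriple (c : Coefficients) (hR : IsSelfAdjoint R)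
    (hinj : Function.Injective R) :
    ∃ (P : EnergySpace H →L[ℂ] EnergySpace H) (d : ℝ),
      IsLyapunovTriple (energyDiag R) (systemOp c R) P 1 d := by
  obtain ⟨k, a, b, ha, hb, hF⟩ := exists_re_inner_crossOp_systemOp_le c hR
  have hδ := c.δ_pos
  have hα := c.α_pos
  have hκ := c.κ_pos
  set μ := min c.α (min c.κ 1) with hμ
  have hμ0 : 0 < μ := by positivity
  -- The first entry makes `N` times the energy dominate the cross terms, with coercivity constant
  -- 1. The second lets the damping `Nδ‖z‖²` pay for `b‖z‖²` and for three Young inequalities, each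
  -- costing `b²/(2a) ‖z‖²`, and still leave `(a/2)‖z‖²`.
  set N := max ((‖crossOp c R k‖ + 1) / μ) ((b + 3 * b ^ 2 / (2 * a) + a / 2) / c.δ) with hN
  have hN0 : 0 ≤ N := le_max_of_le_left (by positivity)
  have hN1 : ‖crossOp c R k‖ + 1 ≤ N * μ := (div_le_iff₀ hμ0).1 (le_max_left _ _)
  have hN2 : b + 3 * b ^ 2 / (2 * a) + a / 2 ≤ N * c.δ := (div_le_iff₀ hδ).1 (le_max_right _ _)
  refine ⟨(N : ℂ) • energyOp c R + crossOp c R k, a / 2, one_pos, by positivity,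
    isSelfAdjoint_energyDiag hR, ?_, commute_energyDiag_systemOp, ?_, ?_, fun x => ?_, fun x => ?_⟩
  · intro x y hxy
    have h (i : Fin 4) : x i = y i := hinj (congrArg (fun v : EnergySpace H => v i) hxy)
    exact energy_ext (h 0) (h 1) (h 2) (h 3)
  · exact (commute_energyDiag_energyOp.smul_right _).add_right (commute_energyDiag_crossOp k)
  · refine IsSelfAdjoint.add ?_ (isSelfAdjoint_crossOp hR k)
    exact IsSelfAdjoint.smul (Complex.conj_ofReal N) (isSelfAdjoint_energyOp hR)
  · rw [add_apply, smul_apply, inner_add_left, inner_smul_left, Complex.conj_ofReal,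
      Complex.add_re, Complex.re_ofReal_mul]
    have h1 := mul_le_mul_of_nonneg_left (re_inner_energyOp (c := c) hR x) hN0
    have h2 : -(⟪crossOp c R k x, x⟫_ℂ).re ≤ ‖crossOp c R k‖ * ‖x‖ ^ 2 := by
      refine (neg_le_abs _).trans ((Complex.abs_re_le_norm _).trans
        ((norm_inner_le_norm _ _).trans ?_))
      rw [sq, ← mul_assoc]
      gcongr
      exact ContinuousLinearMap.le_opNorm _ _
    have h3 := mul_le_mul_of_nonneg_right hN1 (sq_nonneg ‖x‖)
    linarith
  · rw [add_apply, smul_apply, inner_add_left, inner_smul_left, Complex.conj_ofReal,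
      Complex.add_re, Complex.re_ofReal_mul, re_inner_energyOp_systemOp hR, energy_norm_sq]
    have h1 := hF x
    have young : ∀ s : ℝ, b * ‖x 3‖ * s ≤ a / 2 * s ^ 2 + b ^ 2 / (2 * a) * ‖x 3‖ ^ 2 := by
      intro s
      have h2 : a / 2 * s ^ 2 + b ^ 2 / (2 * a) * ‖x 3‖ ^ 2 - b * ‖x 3‖ * s
          = (a * s - b * ‖x 3‖) ^ 2 / (2 * a) := by field_simp; ring
      have h3 : 0 ≤ (a * s - b * ‖x 3‖) ^ 2 / (2 * a) := by positivity
      linarith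
    have y0 := young ‖x 0‖
    have y1 := young ‖x 1‖
    have y2 := young ‖x 2‖
    have h3 := mul_le_mul_of_nonneg_right hN2 (sq_nonneg ‖x 3‖)
    have h4 : 3 * b ^ 2 / (2 * a) = 3 * (b ^ 2 / (2 * a)) := by ring
    rw [h4] at h3
    linarith

end EnergySystem

/-! ### Transfer from the model space to an isomorphic phase space. -/

section Transfer

set_option linter.unusedSectionVars false

variable {K : Type*} [NormedAddCommGroup K] [InnerProductSpace ℂ K] [CompleteSpace K]

theorem openSector_arctan_subset {τ : ℝ} : openSector (Real.arctan τ) ⊆ openCone τ := by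
  rintro ζ ⟨h0, h1⟩
  have hlt : |ζ.arg| < Real.pi / 2 := h1.trans (Real.arctan_lt_pi_div_two τ)
  have hre : 0 < ζ.re := (Complex.abs_arg_lt_pi_div_two_iff.1 hlt).resolve_right h0
  have h2 : Real.tan |ζ.arg| < τ := by
    rw [← Real.tan_arctan τ]
    exact Real.tan_lt_tan_of_lt_of_lt_pi_div_two (by linarith [abs_nonneg ζ.arg, Real.pi_pos])
      (Real.arctan_lt_pi_div_two τ) h1
  have h3 : Real.tan |ζ.arg| = |ζ.im| / ζ.re := by
    rcases abs_cases ζ.arg with ⟨e, hs⟩ | ⟨e, hs⟩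
    · rw [e, Complex.tan_arg, abs_of_nonneg (Complex.arg_nonneg_iff.1 hs)]
    · rw [e, Real.tan_neg, Complex.tan_arg, abs_of_neg (Complex.arg_neg_iff.1 hs), neg_div]
  rw [h3, div_lt_iff₀ hre] at h2
  exact h2

variable {X : Type*} [SeminormedAddCommGroup X] [NormedSpace ℂ X]

/-- The phase space carries only a seminorm structure, so the chain rule with a bounded linear map
is read off the little-o definition. -/
theorem differentiableOn_clm_comp {E F G : Type*} [SeminormedAddCommGroup E] [NormedSpace ℂ E]
    [SeminormedAddCommGroup F] [NormedSpace ℂ F] [SeminormedAddCommGroup G] [NormedSpace ℂ G]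
    (g : F →L[ℂ] G) {f : E → F} {s : Set E} (hf : DifferentiableOn ℂ f s) :
    DifferentiableOn ℂ (fun x => g (f x)) s := by
  intro x hx
  obtain ⟨f', hf'⟩ := hf x hx
  refine ⟨g.comp f', ?_⟩
  rw [hasFDerivWithinAt_iff_isLittleO] at hf' ⊢
  refine ((g.isBigO_comp _ _).trans_isLittleO hf').congr_left fun y => ?_
  simp

/-- The operator on `X` that corresponds to an operator on `K`. -/
def conjOp (Φ : X ≃L[ℂ] K) (D : K →L[ℂ] K) : X →L[ℂ] X :=
  (Φ.symm : K →L[ℂ] X).comp (D.comp (Φ : X →L[ℂ] K))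

theorem conjOp_apply (Φ : X ≃L[ℂ] K) (D : K →L[ℂ] K) (x : X) :
    conjOp Φ D x = Φ.symm (D (Φ x)) := rfl

/-- `conjOp` as a bounded linear map. -/
def conjOpL (Φ : X ≃L[ℂ] K) : (K →L[ℂ] K) →L[ℂ] (X →L[ℂ] X) :=
  ((ContinuousLinearMap.compL ℂ X K X) (Φ.symm : K →L[ℂ] X)).comp
    ((ContinuousLinearMap.compL ℂ X K K).flip (Φ : X →L[ℂ] K))

variable {R M P : K →L[ℂ] K} {m d : ℝ} {B : X →ₗ.[ℂ] X} {Φ : X ≃L[ℂ] K}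

/-- With `J = (μR² - M)⁻¹`, the resolvent of `R⁻²M` is `R²J = JR²`. It is recorded as statements on
the graph, so that no domain has to be named. -/
theorem exists_resolvent_of_graph (h : IsLyapunovTriple R M P m d)
    (hB : ∀ U V, (U, V) ∈ B.graph ↔ R (R (Φ V)) = M (Φ U)) :
    ∃ C : ℝ, 0 ≤ C ∧ ∀ μ : ℂ, 0 ≤ μ.re → ∃ J : K →L[ℂ] K, ‖J‖ ≤ C ∧
      (∀ f, μ • R (R (J f)) - M (J f) = f) ∧ (∀ f, R (R (J f)) = J (R (R f))) ∧
      (∀ U V, (U, V) ∈ B.graph → Φ U = R (R (J (μ • Φ U - Φ V)))) ∧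
      (∀ F, (Φ.symm (R (R (J (Φ F)))), μ • Φ.symm (R (R (J (Φ F)))) - F) ∈ B.graph) := by
  obtain ⟨C, hC, hJ⟩ := h.exists_resolvent
  refine ⟨C, hC, fun μ hμ => ?_⟩
  obtain ⟨J, hJC, hl, hr⟩ := hJ μ hμ
  have hl' : ∀ f, J (μ • R (R f) - M f) = f := fun f => congrArg (fun D : K →L[ℂ] K => D f) hl
  have hr' : ∀ f, μ • R (R (J f)) - M (J f) = f := fun f => congrArg (fun D : K →L[ℂ] K => D f) hr
  have hRM : ∀ f, R (R (M f)) = M (R (R f)) := fun f =>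
    congrArg (fun D : K →L[ℂ] K => D f) ((h.comm_M.mul_left h.comm_M)).eq
  have hcomm : ∀ f, R (R (J f)) = J (R (R f)) := fun f => by
    conv_rhs => rw [← hr' f]
    rw [map_sub, map_smul, map_sub, map_smul, hRM, hl']
  refine ⟨J, hJC, hr', hcomm, fun U V hUV => ?_, fun F => ?_⟩
  · rw [hcomm, map_sub, map_smul, map_sub, map_smul, (hB U V).1 hUV, hl']
  · rw [hB, map_sub, map_smul, ContinuousLinearEquiv.apply_symm_apply, map_sub, map_smul, map_sub,
      map_smul]
    have := congrArg (fun f => R (R f)) (hr' (Φ F))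
    simp only [map_sub, map_smul] at this
    rw [← hRM, ← this]
    abel

theorem mem_resolventSetPMap_of_graph (h : IsLyapunovTriple R M P m d)
    (hB : ∀ U V, (U, V) ∈ B.graph ↔ R (R (Φ V)) = M (Φ U)) {μ : ℂ} (hμ : 0 ≤ μ.re) :
    μ ∈ resolventSetPMap B := by
  obtain ⟨C, -, hC⟩ := exists_resolvent_of_graph h hB
  obtain ⟨J, -, -, -, h1, h2⟩ := hC μ hμ
  refine ⟨conjOp Φ (R * R * J), fun F => ?_, fun U => ?_⟩
  · have hg := h2 F
    obtain ⟨y, hy1, hy2⟩ := (LinearPMap.mem_graph_iff B).1 hg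
    have hy1' : (y : X) = conjOp Φ (R * R * J) F := hy1
    refine ⟨hy1' ▸ y.2, ?_⟩
    have : (⟨conjOp Φ (R * R * J) F, hy1' ▸ y.2⟩ : B.domain) = y := Subtype.ext hy1'.symm
    rw [this, hy2]
    exact sub_sub_cancel _ _
  · have h3 := h1 U (B U) (B.mem_graph U)
    rw [conjOp_apply, map_sub, map_smul]
    exact (Φ.symm_apply_eq).2 h3.symm

theorem exists_norm_sq_le_of_graph (h : IsLyapunovTriple R M P m d)
    (hB : ∀ U V, (U, V) ∈ B.graph ↔ R (R (Φ V)) = M (Φ U)) :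
    ∃ C : ℝ, 0 < C ∧ ∀ (l : ℝ) (F : X) (U : B.domain),
      ((l : ℂ) * Complex.I) • (U : X) - B U = F →
        |l| * ‖(U : X)‖ ^ 2 ≤ C * ‖F‖ * ‖(U : X)‖ := by
  obtain ⟨C, hC0, hC⟩ := exists_resolvent_of_graph h hB
  set C' := ‖(Φ.symm : K →L[ℂ] X)‖ * ((1 + ‖M‖ * C) * ‖(Φ : X →L[ℂ] K)‖) with hC'
  refine ⟨C' + 1, by positivity, fun l F U hF => ?_⟩
  obtain ⟨J, hJ, h0, -, h1, -⟩ := hC ((l : ℂ) * Complex.I) (by simp)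
  have h3 := h1 U (B U) (B.mem_graph U)
  rw [← map_smul, ← map_sub, hF] at h3
  -- The identity `μR²J = 1 + MJ` exhibits `μU` as a vector bounded by `F` uniformly in `μ`, which
  -- is the decay of the resolvent on the imaginary axis.
  have h4 : ((l : ℂ) * Complex.I) • Φ (U : X) = Φ F + M (J (Φ F)) := by
    conv_lhs => rw [h3]
    exact sub_eq_iff_eq_add.1 (h0 (Φ F))
  have h5 : |l| * ‖Φ (U : X)‖ ≤ (1 + ‖M‖ * C) * (‖(Φ : X →L[ℂ] K)‖ * ‖F‖) := by
    have e1 : ‖((l : ℂ) * Complex.I) • Φ (U : X)‖ = |l| * ‖Φ (U : X)‖ := by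
      rw [norm_smul, norm_mul, Complex.norm_I, Complex.norm_real, mul_one, Real.norm_eq_abs]
    rw [← e1, h4]
    calc ‖Φ F + M (J (Φ F))‖ ≤ ‖Φ F‖ + ‖M (J (Φ F))‖ := norm_add_le _ _
      _ ≤ ‖Φ F‖ + ‖M‖ * (C * ‖Φ F‖) := by
        gcongr
        refine (M.le_opNorm _).trans ?_
        gcongr
        refine (J.le_opNorm _).trans ?_
        gcongr
      _ = (1 + ‖M‖ * C) * ‖Φ F‖ := by ring
      _ ≤ _ := by
        gcongr
        exact (Φ : X →L[ℂ] K).le_opNorm F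
  have h6 : ‖(U : X)‖ ≤ ‖(Φ.symm : K →L[ℂ] X)‖ * ‖Φ (U : X)‖ := by
    simpa using (Φ.symm : K →L[ℂ] X).le_opNorm (Φ (U : X))
  calc |l| * ‖(U : X)‖ ^ 2 = |l| * ‖(U : X)‖ * ‖(U : X)‖ := by ring
    _ ≤ |l| * (‖(Φ.symm : K →L[ℂ] X)‖ * ‖Φ (U : X)‖) * ‖(U : X)‖ := by gcongr
    _ = ‖(Φ.symm : K →L[ℂ] X)‖ * (|l| * ‖Φ (U : X)‖) * ‖(U : X)‖ := by ring
    _ ≤ ‖(Φ.symm : K →L[ℂ] X)‖ * ((1 + ‖M‖ * C) * (‖(Φ : X →L[ℂ] K)‖ * ‖F‖)) * ‖(U : X)‖ := by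
      gcongr
    _ = C' * ‖F‖ * ‖(U : X)‖ := by rw [hC']; ring
    _ ≤ _ := by gcongr; linarith

theorem isC0Semigroup_of_graph (h : IsLyapunovTriple R M P m d)
    (hB : ∀ U V, (U, V) ∈ B.graph ↔ R (R (Φ V)) = M (Φ U)) :
    IsC0SemigroupGeneratedBy B
      fun t : ℝ≥0 => conjOp Φ (IsLyapunovTriple.semigroup R M ((t : ℝ) : ℂ)) where
  map_zero := by
    ext x
    simp [conjOp_apply, h.semigroup_zero]
  map_add s t := by
    ext x
    simp only [NNReal.coe_add, Complex.ofReal_add, conjOp_apply, ContinuousLinearMap.comp_apply,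
      ContinuousLinearEquiv.apply_symm_apply,
      h.semigroup_add (h.ofReal_mem_insert_openCone s) (h.ofReal_mem_insert_openCone t)]
    rfl
  tendsto_zero x := by
    have := (Φ.symm.continuous.tendsto _).comp (h.tendsto_semigroup_ofReal (Φ x))
    rwa [ContinuousLinearEquiv.symm_apply_apply] at this
  generator x y := by
    rw [hB, h.graph_iff_tendsto]
    constructor
    · intro hy
      have := (Φ.symm.continuous.tendsto _).comp hy
      rw [ContinuousLinearEquiv.symm_apply_apply] at this
      refine this.congr fun t => ?_
      simp [conjOp_apply, map_sub]
    · intro hy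
      refine ((Φ.continuous.tendsto _).comp hy).congr fun t => ?_
      simp [conjOp_apply, map_sub]

theorem isAnalyticSemigroup_conjOp (h : IsLyapunovTriple R M P m d) :
    IsAnalyticSemigroup
      fun t : ℝ≥0 => conjOp Φ (IsLyapunovTriple.semigroup R M ((t : ℝ) : ℂ)) := by
  have hsub : openSector (Real.arctan (IsLyapunovTriple.slope M P d)) ⊆
      insert 0 (openCone (IsLyapunovTriple.slope M P d)) :=
    openSector_arctan_subset.trans (Set.subset_insert _ _)
  refine ⟨Real.arctan (IsLyapunovTriple.slope M P d), Real.arctan_pos.2 h.slope_pos,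
    (Real.arctan_lt_pi_div_two _).le, fun ζ => conjOp Φ (IsLyapunovTriple.semigroup R M ζ),
    fun _ => rfl, ?_, fun a ha b hb => ?_, fun x => ?_⟩
  · exact differentiableOn_clm_comp (conjOpL Φ)
      (h.differentiableOn_semigroup.mono openSector_arctan_subset)
  · ext x
    simp only [conjOp_apply, ContinuousLinearMap.comp_apply,
      ContinuousLinearEquiv.apply_symm_apply, h.semigroup_add (hsub ha) (hsub hb)]
    rfl
  · have := (Φ.symm.continuous.tendsto _).comp
      ((h.tendsto_semigroup_apply (Φ x)).mono_left (nhdsWithin_mono 0 hsub))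
    rwa [ContinuousLinearEquiv.symm_apply_apply] at this

end Transfer

/-! ### Energy coordinates on the phase space and the graph of the generator. -/

section PhaseSpaceCoordinates

set_option linter.unusedSectionVars false

variable {H : Type*} [NormedAddCommGroup H] [InnerProductSpace ℂ H] [CompleteSpace H]

theorem isBoundedInverse_unique {A : H →ₗ.[ℂ] H} {T T' : H →L[ℂ] H} (h : IsBoundedInverse A T)
    (h' : IsBoundedInverse A T') : T = T' := by
  ext f
  obtain ⟨hf, e⟩ := h.1 f
  have := h'.2 ⟨T f, hf⟩
  rw [e] at this
  exact this.symm

theorem boundedInverse_eq {A : H →ₗ.[ℂ] H} {T : H →L[ℂ] H} (h : IsBoundedInverse A T) :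
    boundedInverse A = T := by
  have hex : ∃ T : H →L[ℂ] H, IsBoundedInverse A T := ⟨T, h⟩
  rw [boundedInverse, dif_pos hex]
  exact isBoundedInverse_unique hex.choose_spec h

theorem isBoundedInverse_fracPow {A : H →ₗ.[ℂ] H} {s : ℝ} {D : H →L[ℂ] H}
    (hD : negPow A s = D) (hinj : Function.Injective D) :
    IsBoundedInverse (fracPow A s) D := by
  set g : H →ₗ.[ℂ] H := (D : H →ₗ[ℂ] H).toPMap ⊤ with hg
  have hfrac : fracPow A s = g.inverse := by rw [fracPow, hD]
  have hker : LinearMap.ker g.toFun = ⊥ := by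
    refine LinearMap.ker_eq_bot.2 fun x y hxy => Subtype.ext (hinj ?_)
    exact hxy
  rw [hfrac]
  have hval : ∀ f : H, ∃ h : D f ∈ g.inverse.domain, g.inverse ⟨D f, h⟩ = f := by
    intro f
    have hmem : D f ∈ g.inverse.domain := by
      rw [LinearPMap.inverse_domain]
      exact ⟨⟨f, trivial⟩, rfl⟩
    exact ⟨hmem, LinearPMap.inverse_apply_eq hker (x := ⟨f, trivial⟩) rfl⟩
  refine ⟨hval, fun u => ?_⟩
  have hu : (u : H) ∈ LinearMap.range g.toFun := g.inverse_domain ▸ u.2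
  obtain ⟨⟨f, hf⟩, hfu⟩ := hu
  have hfu' : D f = u := hfu
  obtain ⟨h1, h2⟩ := hval f
  have : u = ⟨D f, h1⟩ := Subtype.ext hfu'.symm
  rw [this, h2]

variable {c : Coefficients} {A : H →ₗ.[ℂ] H} {R : H →L[ℂ] H}

/-- The coordinates `(Au, A^{1/2}v, A^{1/2}w, z)` on the phase space. -/
def phaseEquiv (c : Coefficients) (hA : IsBoundedInverse A (R * R * (R * R)))
    (hF : IsBoundedInverse (fracPow A (1 / 2)) (R * R)) :
    PhaseSpace c 1 A ≃ₗ[ℂ] EnergySpace H where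
  toFun U := WithLp.toLp 2 ![A U.u, fracPow A (1 / 2) U.v, fracPow A (1 / 2) U.w, U.z]
  map_add' U V := by
    refine energy_ext ?_ ?_ ?_ ?_ <;> simp [LinearPMap.map_add]
  map_smul' r U := by
    refine energy_ext ?_ ?_ ?_ ?_ <;> simp [LinearPMap.map_smul]
  invFun x := (⟨(R * R * (R * R)) (x 0), (hA.1 (x 0)).1⟩, ⟨(R * R) (x 1), (hF.1 (x 1)).1⟩,
    ⟨(R * R) (x 2), (hF.1 (x 2)).1⟩, x 3)
  left_inv U := by
    refine Prod.ext (Subtype.ext (hA.2 U.u)) (Prod.ext (Subtype.ext (hF.2 U.v))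
      (Prod.ext (Subtype.ext (hF.2 U.w)) rfl))
  right_inv x := energy_ext (hA.1 (x 0)).2 (hF.1 (x 1)).2 (hF.1 (x 2)).2 rfl

section Coordinates

variable (hA : IsBoundedInverse A (R * R * (R * R)))
  (hF : IsBoundedInverse (fracPow A (1 / 2)) (R * R)) (U : PhaseSpace c 1 A)

theorem phaseEquiv_zero : phaseEquiv c hA hF U 0 = A U.u := rfl
theorem phaseEquiv_one : phaseEquiv c hA hF U 1 = fracPow A (1 / 2) U.v := rfl
theorem phaseEquiv_two : phaseEquiv c hA hF U 2 = fracPow A (1 / 2) U.w := rfl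
theorem phaseEquiv_three : phaseEquiv c hA hF U 3 = U.z := rfl

theorem R_phaseEquiv_zero : R (R (R (R (phaseEquiv c hA hF U 0)))) = U.u := hA.2 U.u
theorem R_phaseEquiv_one : R (R (phaseEquiv c hA hF U 1)) = U.v := hF.2 U.v
theorem R_phaseEquiv_two : R (R (phaseEquiv c hA hF U 2)) = U.w := hF.2 U.w

theorem norm_phaseEquiv_le :
    ‖phaseEquiv c hA hF U‖ ≤ √((min c.α (min c.κ 1))⁻¹) * ‖U‖ := by
  have hα := c.α_pos
  have hκ := c.κ_pos
  set μ := min c.α (min c.κ 1)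
  have hμ : 0 < μ := by positivity
  refine abs_le_of_sq_le_sq' ?_ (by positivity) |>.2
  rw [mul_pow, Real.sq_sqrt (by positivity), ← div_eq_inv_mul, le_div_iff₀ hμ,
    PhaseSpace.norm_sq, energy_norm_sq]
  simp only [phaseEquiv_zero, phaseEquiv_one, phaseEquiv_two, phaseEquiv_three]
  have a1 : μ ≤ c.α := min_le_left _ _
  have a2 : μ ≤ c.κ := (min_le_right _ _).trans (min_le_left _ _)
  have a3 : μ ≤ 1 := (min_le_right _ _).trans (min_le_right _ _)
  have e0 := mul_le_mul_of_nonneg_right a1 (sq_nonneg ‖A U.u‖)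
  have e1 := mul_le_mul_of_nonneg_right a1 (sq_nonneg ‖fracPow A (1 / 2) U.v‖)
  have e2 := mul_le_mul_of_nonneg_right a2 (sq_nonneg ‖fracPow A (1 / 2) U.w‖)
  have e3 := mul_le_mul_of_nonneg_right a3 (sq_nonneg ‖U.z‖)
  have e4 := sq_nonneg ‖(U.w : H)‖
  linarith

/-- Only the term `‖w‖²` is not a multiple of a squared coordinate; it is controlled by `w =
R²(A^{1/2}w)`, with `R² = A^{-1/2}` bounded. -/
theorem norm_le_phaseEquiv :
    ‖U‖ ≤ √(c.α + ‖R * R‖ ^ 2 + c.κ + 1) * ‖phaseEquiv c hA hF U‖ := by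
  have hα := c.α_pos
  have hκ := c.κ_pos
  refine abs_le_of_sq_le_sq' ?_ (by positivity) |>.2
  rw [mul_pow, Real.sq_sqrt (by positivity), PhaseSpace.norm_sq, energy_norm_sq]
  have hw : ‖(U.w : H)‖ ≤ ‖R * R‖ * ‖fracPow A (1 / 2) U.w‖ := by
    conv_lhs => rw [← hF.2 U.w]
    exact (R * R).le_opNorm _
  have hw2 : ‖(U.w : H)‖ ^ 2 ≤ ‖R * R‖ ^ 2 * ‖fracPow A (1 / 2) U.w‖ ^ 2 := by
    rw [← mul_pow]; gcongr
  simp only [phaseEquiv_zero, phaseEquiv_one, phaseEquiv_two, phaseEquiv_three]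
  have q0 := sq_nonneg ‖A U.u‖
  have q1 := sq_nonneg ‖fracPow A (1 / 2) U.v‖
  have q2 := sq_nonneg ‖fracPow A (1 / 2) U.w‖
  have q3 := sq_nonneg ‖U.z‖
  have q4 := sq_nonneg ‖R * R‖
  generalize ‖A U.u‖ ^ 2 = p0 at *
  generalize ‖fracPow A (1 / 2) U.v‖ ^ 2 = p1 at *
  generalize ‖U.z‖ ^ 2 = p3 at *
  generalize ‖R * R‖ ^ 2 = p4 at *
  have hw3 : c.κ * ‖fracPow A (1 / 2) U.w‖ ^ 2 + ‖(U.w : H)‖ ^ 2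
      ≤ (c.κ + p4) * ‖fracPow A (1 / 2) U.w‖ ^ 2 := by linarith
  have hs : 0 ≤ (p4 + c.κ + 1) * (p0 + p1) + (c.α + 1) * ‖fracPow A (1 / 2) U.w‖ ^ 2
    + (c.α + p4 + c.κ) * p3 := by positivity
  linarith

/-- The coordinates on the phase space as a homeomorphism. -/
def phaseEquivL (c : Coefficients) (hA : IsBoundedInverse A (R * R * (R * R)))
    (hF : IsBoundedInverse (fracPow A (1 / 2)) (R * R)) :
    PhaseSpace c 1 A ≃L[ℂ] EnergySpace H :=
  (phaseEquiv c hA hF).toContinuousLinearEquivOfBounds _ (√(c.α + ‖R * R‖ ^ 2 + c.κ + 1))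
    (norm_phaseEquiv_le hA hF) fun x => by
      simpa using norm_le_phaseEquiv hA hF ((phaseEquiv c hA hF).symm x)

end Coordinates

/-- Each of the four defining conditions becomes one component of `R²y = Mx` after unbounded
operators are replaced by powers of `R`; injectivity of `R` makes these passages reversible. -/
theorem mem_generatorGraph_iff (hR : IsSelfAdjoint R) (hinj : Function.Injective R)
    (hpow : negPow A (1 / 2) = R * R)
    (hA : IsBoundedInverse A (R * R * (R * R)))
    (hF : IsBoundedInverse (fracPow A (1 / 2)) (R * R)) (U V : PhaseSpace c 1 A) :
    (U, V) ∈ generatorGraph c (1 / 2) 1 A ↔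
      energyDiag R (energyDiag R (phaseEquiv c hA hF V)) = systemOp c R (phaseEquiv c hA hF U) := by
  set x := phaseEquiv c hA hF U with hx
  set y := phaseEquiv c hA hF V with hy
  have hsymm : ∀ a b, ⟪R a, b⟫_ℂ = ⟪a, R b⟫_ℂ := hR.isSymmetric
  have hinj2 : Function.Injective fun a => R (R a) := hinj.comp hinj
  have c1 : (V.u : H) = U.w ↔ R (R (y 0)) = x 2 := by
    rw [← R_phaseEquiv_zero hA hF V, ← R_phaseEquiv_two hA hF U]
    exact hinj2.eq_iff
  have c2 : (V.v : H) = U.z ↔ R (R (y 1)) = x 3 := by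
    rw [← R_phaseEquiv_one hA hF V]
    exact Iff.rfl
  have c3 : (∀ (φ : A.domain) (ψ : (fracPow A ((1 : ℝ) / 2)).domain), (φ : H) = ψ →
      ⟪(φ : H), (V.w : H)⟫_ℂ + c.κ * ⟪fracPow A (1 / 2) ψ, fracPow A (1 / 2) V.w⟫_ℂ
        = -c.α * ⟪A φ, A U.u⟫_ℂ - c.γ * ⟪A φ, U.z⟫_ℂ) ↔
      R (R (y 2)) = -Ring.inverse (massOp c R) ((c.α : ℂ) • x 0 + (c.γ : ℂ) • x 3) := by
    -- The test vectors are `φ = A⁻¹f = R⁴f` with `f` arbitrary in `H`, so that `Aφ = f` and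
    -- `A^{1/2}φ = R²f`; the weak equation becomes an equality of vectors.
    have key : ∀ f : H, ⟪R (R (R (R f))), (V.w : H)⟫_ℂ + c.κ * ⟪R (R f), y 2⟫_ℂ
        = ⟪f, massOp c R (R (R (y 2)))⟫_ℂ := by
      intro f
      rw [← R_phaseEquiv_two hA hF V]
      simp [massOp, hsymm, hy]
    have key2 : ∀ f : H, -c.α * ⟪f, A U.u⟫_ℂ - c.γ * ⟪f, U.z⟫_ℂ
        = ⟪f, -((c.α : ℂ) • x 0 + (c.γ : ℂ) • x 3)⟫_ℂ := by
      intro f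
      rw [inner_neg_right, inner_add_right, inner_smul_right, inner_smul_right]
      change _ = -(c.α * ⟪f, A U.u⟫_ℂ + c.γ * ⟪f, U.z⟫_ℂ)
      ring
    have hiff : R (R (y 2)) = -Ring.inverse (massOp c R) ((c.α : ℂ) • x 0 + (c.γ : ℂ) • x 3) ↔
        massOp c R (R (R (y 2))) = -((c.α : ℂ) • x 0 + (c.γ : ℂ) • x 3) := by
      constructor
      · intro h
        rw [h, map_neg, massOp_inverse_apply hR]
      · intro h
        have e : Ring.inverse (massOp c R) (massOp c R (R (R (y 2)))) = R (R (y 2)) := by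
          have := congrArg (fun D : H →L[ℂ] H => D (R (R (y 2))))
            (Ring.inverse_mul_cancel _ (isUnit_massOp (c := c) hR))
          simpa using this
        rw [← e, h, map_neg]
    rw [hiff]
    constructor
    · intro h
      refine ext_inner_left ℂ fun f => ?_
      obtain ⟨h1, e1⟩ := hA.1 f
      obtain ⟨h2, e2⟩ := hF.1 (R (R f))
      have h3 := h ⟨_, h1⟩ ⟨_, h2⟩ rfl
      rw [e1, e2] at h3
      rw [← key, ← key2]
      exact h3
    · intro h φ ψ hφψ
      have e1 : (φ : H) = R (R (R (R (A φ)))) := (hA.2 φ).symm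
      have e2 : fracPow A (1 / 2) ψ = R (R (A φ)) := by
        refine hinj2 ?_
        change R (R (fracPow A (1 / 2) ψ)) = R (R (R (R (A φ))))
        rw [← e1, hφψ]
        exact hF.2 ψ
      rw [key2, ← h, ← key, e2, ← e1]
      rfl
  have c4 : (∃ a : A.domain, (a : H) = (c.α : ℂ) • (U.v : H)
      + (c.δ : ℂ) • negPow A (1 - 1 / 2) U.z ∧ V.z = -A a + (c.γ : ℂ) • A V.u) ↔
      R (R (y 3)) = -(c.α : ℂ) • x 1 + (c.γ : ℂ) • R (R (y 0)) - (c.δ : ℂ) • x 3 := by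
    have hhalf : (1 : ℝ) - 1 / 2 = 1 / 2 := by norm_num
    rw [hhalf, hpow, ← R_phaseEquiv_one hA hF U]
    constructor
    · rintro ⟨a, ha, hz⟩
      have e1 : R (R (A a)) = (c.α : ℂ) • x 1 + (c.δ : ℂ) • x 3 := by
        refine hinj2 ?_
        have := hA.2 a
        change R (R (R (R (A a)))) = _
        change R (R (R (R (A a)))) = _ at this
        rw [this, ha]
        simp only [map_add, map_smul]
        rfl
      have e2 : y 3 = -A a + (c.γ : ℂ) • y 0 := hz
      rw [e2]
      simp only [map_add, map_neg, map_smul, e1]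
      module
    · intro h
      set b := (c.γ : ℂ) • y 0 - y 3 with hb
      obtain ⟨h1, e1⟩ := hA.1 b
      have e2 : R (R b) = (c.α : ℂ) • x 1 + (c.δ : ℂ) • x 3 := by
        rw [hb]
        simp only [map_sub, map_smul, h]
        module
      refine ⟨⟨_, h1⟩, ?_, ?_⟩
      · change R (R (R (R b))) = _
        rw [e2]
        simp only [map_add, map_smul]
        rfl
      · rw [e1, hb]
        change y 3 = -((c.γ : ℂ) • y 0 - y 3) + (c.γ : ℂ) • y 0
        abel
  have hsplit : energyDiag R (energyDiag R y) = systemOp c R x ↔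
      R (R (y 0)) = x 2 ∧ R (R (y 1)) = x 3 ∧
      R (R (y 2)) = -Ring.inverse (massOp c R) ((c.α : ℂ) • x 0 + (c.γ : ℂ) • x 3) ∧
      R (R (y 3)) = -(c.α : ℂ) • x 1 + (c.γ : ℂ) • x 2 - (c.δ : ℂ) • x 3 := by
    constructor
    · intro h
      have hi (i : Fin 4) := congrArg (fun v : EnergySpace H => v i) h
      exact ⟨hi 0, hi 1, hi 2, hi 3⟩
    · rintro ⟨h0, h1, h2, h3⟩
      exact energy_ext h0 h1 h2 h3
  rw [hsplit]
  change ((V.u : H) = U.w ∧ (V.v : H) = U.z ∧ _ ∧ _) ↔ _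
  rw [c1, c2]
  refine and_congr_right fun h0 => and_congr_right fun _ => and_congr c3 ?_
  -- The fourth component contains `γx₂`, whereas the definition supplies `γR²y₀`; the first
  -- equation identifies them.
  rw [← h0]
  exact c4

theorem generator_graph_iff (hR : IsSelfAdjoint R) (hinj : Function.Injective R)
    (hpow : negPow A (1 / 2) = R * R)
    (hA : IsBoundedInverse A (R * R * (R * R)))
    (hF : IsBoundedInverse (fracPow A (1 / 2)) (R * R)) (U V : PhaseSpace c 1 A) :
    (U, V) ∈ (generator c (1 / 2) 1 A).graph ↔
      energyDiag R (energyDiag R (phaseEquivL c hA hF V))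
        = systemOp c R (phaseEquivL c hA hF U) := by
  have hiff := mem_generatorGraph_iff (c := c) hR hinj hpow hA hF
  rw [generator, Submodule.toLinearPMap_graph_eq]
  · exact hiff U V
  -- The relation is single valued: `U = 0` gives `R²y = 0`, hence `y = 0`.
  · rintro ⟨U, V⟩ hUV (hU : U = 0)
    subst hU
    have h1 := (hiff 0 V).1 hUV
    rw [map_zero, map_zero] at h1
    refine (phaseEquiv c hA hF).injective ?_
    rw [map_zero]
    have hi (i : Fin 4) : phaseEquiv c hA hF V i = 0 := by
      have h2 : R (R (phaseEquiv c hA hF V i)) = 0 := congrArg (fun v : EnergySpace H => v i) h1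
      exact (hinj.comp hinj) (by simpa using h2)
    exact energy_ext (hi 0) (hi 1) (hi 2) (hi 3)

end PhaseSpaceCoordinates

/-! ### The Dirichlet Laplacian: Poincaré inequality and bounded inverse. -/

section DirichletForm

variable {n : ℕ}

/-- Integration by parts with the multiplier `xᵢ`. -/
theorem integral_conj_mul_self_eq (i : Fin n) {φ : EuclideanSpace ℝ (Fin n) → ℂ}
    (hφ : ContDiff ℝ (⊤ : ℕ∞) φ) (hc : HasCompactSupport φ) :
    ∫ x, (starRingEnd ℂ) (φ x) * φ x
      = -(∫ x, (starRingEnd ℂ) (φ x) * ((x i : ℂ) * fderiv ℝ φ x (EuclideanSpace.single i 1)))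
        - ∫ x, (starRingEnd ℂ) ((x i : ℂ) * fderiv ℝ φ x (EuclideanSpace.single i 1)) * φ x := by
  set e : EuclideanSpace ℝ (Fin n) := EuclideanSpace.single i 1
  have hd : Differentiable ℝ φ := hφ.differentiable (by simp)
  have hdc : Continuous fun x => fderiv ℝ φ x e :=
    (hφ.continuous_fderiv (by simp)).clm_apply continuous_const
  have hxc : Continuous fun x : EuclideanSpace ℝ (Fin n) => ((x i : ℝ) : ℂ) := by fun_prop
  have hconj : Continuous fun x => (starRingEnd ℂ) (φ x) :=
    Complex.continuous_conj.comp hφ.continuous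
  have hx : ∀ x : EuclideanSpace ℝ (Fin n), HasFDerivAt (fun y => ((y i : ℝ) : ℂ))
      (Complex.ofRealCLM.comp (EuclideanSpace.proj i : EuclideanSpace ℝ (Fin n) →L[ℝ] ℝ)) x :=
    fun x => (Complex.ofRealCLM.comp
      (EuclideanSpace.proj i : EuclideanSpace ℝ (Fin n) →L[ℝ] ℝ)).hasFDerivAt
  have hf : ∀ x, HasFDerivAt (fun y => ((y i : ℝ) : ℂ) * φ y)
      (((x i : ℝ) : ℂ) • fderiv ℝ φ x + φ x • Complex.ofRealCLM.comp
        (EuclideanSpace.proj i : EuclideanSpace ℝ (Fin n) →L[ℝ] ℝ)) x :=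
    fun x => (hx x).mul (hd x).hasFDerivAt
  have hg : ∀ x, HasFDerivAt (fun y => (starRingEnd ℂ) (φ y))
      ((Complex.conjCLE : ℂ →L[ℝ] ℂ).comp (fderiv ℝ φ x)) x :=
    fun x => (Complex.conjCLE : ℂ →L[ℝ] ℂ).hasFDerivAt.comp x (hd x).hasFDerivAt
  have hf' : ∀ x, fderiv ℝ (fun y => ((y i : ℝ) : ℂ) * φ y) x e
      = ((x i : ℝ) : ℂ) * fderiv ℝ φ x e + φ x := by
    intro x
    rw [(hf x).fderiv]
    simp [e]
  have hg' : ∀ x, fderiv ℝ (fun y => (starRingEnd ℂ) (φ y)) x e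
      = (starRingEnd ℂ) (fderiv ℝ φ x e) := by
    intro x
    rw [(hg x).fderiv]
    simp
  have hcc : HasCompactSupport fun x => (starRingEnd ℂ) (φ x) :=
    hc.comp_left (g := starRingEnd ℂ) (map_zero _)
  have i1 : Integrable fun x => ((x i : ℝ) : ℂ) * fderiv ℝ φ x e * (starRingEnd ℂ) (φ x) :=
    ((hxc.mul hdc).mul hconj).integrable_of_hasCompactSupport hcc.mul_left
  have i2 : Integrable fun x => φ x * (starRingEnd ℂ) (φ x) :=
    (hφ.continuous.mul hconj).integrable_of_hasCompactSupport hcc.mul_left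
  have i3 : Integrable fun x => ((x i : ℝ) : ℂ) * φ x * (starRingEnd ℂ) (fderiv ℝ φ x e) :=
    ((hxc.mul hφ.continuous).mul (Complex.continuous_conj.comp hdc)).integrable_of_hasCompactSupport
      (HasCompactSupport.mul_right hc.mul_left)
  have i4 : Integrable fun x => ((x i : ℝ) : ℂ) * φ x * (starRingEnd ℂ) (φ x) :=
    ((hxc.mul hφ.continuous).mul hconj).integrable_of_hasCompactSupport hcc.mul_left
  have key := integral_mul_fderiv_eq_neg_fderiv_mul_of_integrable (μ := volume) (𝕜 := ℂ) (v := e)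
    (f := fun y => ((y i : ℝ) : ℂ) * φ y) (g := fun y => (starRingEnd ℂ) (φ y))
    (by simp only [hf', add_mul]; exact i1.add i2) (by simp only [hg']; exact i3) i4
    (fun x _ => (hf x).differentiableAt) (fun x _ => (hg x).differentiableAt)
  simp only [hf', hg', add_mul] at key
  rw [integral_add i1 i2] at key
  have k1 : ∫ x, (starRingEnd ℂ) (φ x) * φ x = ∫ x, φ x * (starRingEnd ℂ) (φ x) := by
    simp only [mul_comm]
  have k2 : ∫ x, (starRingEnd ℂ) (φ x) * ((x i : ℂ) * fderiv ℝ φ x e)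
      = ∫ x, ((x i : ℝ) : ℂ) * fderiv ℝ φ x e * (starRingEnd ℂ) (φ x) := by
    simp only [mul_comm]
  have k3 : ∫ x, (starRingEnd ℂ) ((x i : ℂ) * fderiv ℝ φ x e) * φ x
      = ∫ x, ((x i : ℝ) : ℂ) * φ x * (starRingEnd ℂ) (fderiv ℝ φ x e) := by
    refine integral_congr_ae (Eventually.of_forall fun x => ?_)
    simp only [map_mul, Complex.conj_ofReal]
    ring
  rw [k1, k2, k3, key]
  ring

variable {Ω : Opens (EuclideanSpace ℝ (Fin n))}

theorem inner_L2_eq_integral {f g : L2 Ω} {a b : EuclideanSpace ℝ (Fin n) → ℂ}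
    (hf : f =ᵐ[volume.restrict (Ω : Set _)] a) (hg : g =ᵐ[volume.restrict (Ω : Set _)] b)
    (hs : ∀ x ∉ (Ω : Set (EuclideanSpace ℝ (Fin n))), (starRingEnd ℂ) (a x) * b x = 0) :
    ⟪f, g⟫_ℂ = ∫ x, (starRingEnd ℂ) (a x) * b x := by
  rw [L2.inner_def, ← setIntegral_eq_integral_of_forall_compl_eq_zero hs]
  refine integral_congr_ae ?_
  filter_upwards [hf, hg] with x hx hx'
  rw [hx, hx', RCLike.inner_apply, mul_comm]

/-- The Poincaré inequality for test functions. -/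
theorem norm_le_of_mem_testGradient {ρ : ℝ} (hρ : 0 ≤ ρ)
    (hΩ : ∀ x ∈ Ω, ‖x‖ ≤ ρ) (i : Fin n) {p : L2 Ω × (Fin n → L2 Ω)} (hp : p ∈ testGradient Ω) :
    ‖p.1‖ ≤ 2 * ρ * ‖p.2 i‖ := by
  obtain ⟨φ, h1, h2⟩ := hp
  have hdiff : ContDiff ℝ (⊤ : ℕ∞) φ := φ.contDiff
  have hcs : HasCompactSupport φ := φ.hasCompactSupport
  set e : EuclideanSpace ℝ (Fin n) := EuclideanSpace.single i 1
  set b : EuclideanSpace ℝ (Fin n) → ℂ := fun x => (x i : ℂ) * fderiv ℝ φ x e with hb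
  have hdc : Continuous fun x => fderiv ℝ φ x e :=
    (hdiff.continuous_fderiv (by simp)).clm_apply continuous_const
  have hxc : Continuous fun x : EuclideanSpace ℝ (Fin n) => ((x i : ℝ) : ℂ) := by fun_prop
  have hbm : MemLp b 2 (volume.restrict (Ω : Set (EuclideanSpace ℝ (Fin n)))) :=
    (hxc.mul hdc).memLp_of_hasCompactSupport (hcs.fderiv_apply ℝ e).mul_left
  set m : L2 Ω := hbm.toLp b with hm
  have hmb : m =ᵐ[volume.restrict (Ω : Set _)] b := hbm.coeFn_toLp
  have hzero : ∀ x ∉ (Ω : Set (EuclideanSpace ℝ (Fin n))), φ x = 0 := fun x hx =>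
    image_eq_zero_of_notMem_tsupport fun h => hx (φ.tsupport_subset h)
  -- Since `∂ᵢxᵢ = 1`, this writes `‖φ‖²` as `-2 Re⟪φ, xᵢ∂ᵢφ⟫`; on `Ω` one has `|xᵢ| ≤ ρ`, whence
  -- the constant `2ρ`.
  have hid := integral_conj_mul_self_eq i hdiff hcs
  rw [← inner_L2_eq_integral h1 h1 (fun x hx => by simp [hzero x hx]),
    ← inner_L2_eq_integral h1 hmb (fun x hx => by simp [hzero x hx]),
    ← inner_L2_eq_integral hmb h1 (fun x hx => by simp [hzero x hx])] at hid
  have hmn : ‖m‖ ≤ ρ * ‖p.2 i‖ := by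
    refine Lp.norm_le_mul_norm_of_ae_le_mul ?_
    filter_upwards [hmb, h2 i, ae_restrict_mem Ω.isOpen.measurableSet] with x hx hx2 hxΩ
    rw [hx, hx2, hb, norm_mul, Complex.norm_real]
    gcongr
    exact (PiLp.norm_apply_le x i).trans (hΩ x hxΩ)
  have hsq : ‖p.1‖ ^ 2 ≤ 2 * (‖p.1‖ * ‖m‖) := by
    have h3 : ‖⟪p.1, p.1⟫_ℂ‖ = ‖p.1‖ ^ 2 := by
      rw [inner_self_eq_norm_sq_to_K]; simp
    rw [← h3, hid]
    refine (norm_sub_le _ _).trans ?_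
    rw [norm_neg]
    have h4 := norm_inner_le_norm (𝕜 := ℂ) p.1 m
    have h5 := norm_inner_le_norm (𝕜 := ℂ) m p.1
    linarith
  rcases (norm_nonneg p.1).eq_or_lt with h0 | h0
  · rw [← h0]; positivity
  · nlinarith

/-- The Poincaré inequality on `H¹₀(Ω)`. -/
theorem norm_le_of_mem_sobolevH10 {ρ : ℝ} (hρ : 0 ≤ ρ)
    (hΩ : ∀ x ∈ Ω, ‖x‖ ≤ ρ) (i : Fin n) {p : L2 Ω × (Fin n → L2 Ω)} (hp : p ∈ sobolevH10 Ω) :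
    ‖p.1‖ ≤ 2 * ρ * ‖p.2 i‖ := by
  have hcl : IsClosed {p : L2 Ω × (Fin n → L2 Ω) | ‖p.1‖ ≤ 2 * ρ * ‖p.2 i‖} :=
    isClosed_le (by fun_prop) (by fun_prop)
  exact closure_minimal (fun p hp => norm_le_of_mem_testGradient hρ hΩ i hp) hcl hp

theorem exists_mem_testGradient (φ : 𝓓(Ω, ℂ)) : ∃ p ∈ testGradient Ω,
    p.1 =ᵐ[volume.restrict (Ω : Set _)] φ := by
  have hdiff : ContDiff ℝ (⊤ : ℕ∞) φ := φ.contDiff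
  have hcs : HasCompactSupport φ := φ.hasCompactSupport
  have h1 : MemLp φ 2 (volume.restrict (Ω : Set (EuclideanSpace ℝ (Fin n)))) :=
    hdiff.continuous.memLp_of_hasCompactSupport hcs
  have h2 : ∀ i, MemLp (fun x => fderiv ℝ φ x (EuclideanSpace.single i 1)) 2
      (volume.restrict (Ω : Set (EuclideanSpace ℝ (Fin n)))) := fun i =>
    ((hdiff.continuous_fderiv (by simp)).clm_apply continuous_const).memLp_of_hasCompactSupport
      (hcs.fderiv_apply ℝ _)
  exact ⟨(h1.toLp _, fun i => (h2 i).toLp _), ⟨φ, h1.coeFn_toLp, fun i => (h2 i).coeFn_toLp⟩,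
    h1.coeFn_toLp⟩

/-- The test functions are dense in `L²(Ω)`. -/
theorem eq_zero_of_inner_testGradient {f : L2 Ω} (h : ∀ q ∈ testGradient Ω, ⟪q.1, f⟫_ℂ = 0) :
    f = 0 := by
  have hloc : LocallyIntegrableOn f (Ω : Set (EuclideanSpace ℝ (Fin n)))
      (volume.restrict (Ω : Set (EuclideanSpace ℝ (Fin n)))) :=
    ((Lp.memLp f).locallyIntegrable (by norm_num)).locallyIntegrableOn _
  have hae := Ω.isOpen.ae_eq_zero_of_integral_contDiff_smul_eq_zero hloc fun g hg hgc hgs => by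
    have hts : tsupport (fun x => (g x : ℂ)) ⊆ tsupport g :=
      closure_mono fun x hx => by simpa using hx
    obtain ⟨q, hq, hqe⟩ := exists_mem_testGradient (Ω := Ω)
      ⟨fun x => (g x : ℂ), Complex.ofRealCLM.contDiff.comp hg,
        hgc.comp_left (g := Complex.ofReal) Complex.ofReal_zero, hts.trans hgs⟩
    have := h q hq
    rw [L2.inner_def] at this
    rw [← this]
    refine integral_congr_ae ?_
    filter_upwards [hqe] with x hx
    have hx' : q.1 x = (g x : ℂ) := hx
    rw [hx', RCLike.inner_apply, Complex.conj_ofReal, Complex.real_smul, mul_comm]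
  rw [Lp.eq_zero_iff_ae_eq_zero]
  filter_upwards [hae, ae_restrict_mem Ω.isOpen.measurableSet] with x hx hxΩ
  exact hx hxΩ

/-- The abstract weak problem: the equation reads `J*Jp = I*f`, and `J*J` is coercive, so `L =
(J*J)⁻¹I*`. -/
theorem exists_inner_comp_inverse {E W G : Type*} [NormedAddCommGroup E] [InnerProductSpace ℂ E]
    [CompleteSpace E] [NormedAddCommGroup W] [InnerProductSpace ℂ W] [CompleteSpace W]
    [NormedAddCommGroup G] [InnerProductSpace ℂ G] [CompleteSpace G]
    (I : W →L[ℂ] E) (J : W →L[ℂ] G) {c : ℝ} (hc : 0 < c) (hJ : ∀ p, c * ‖p‖ ^ 2 ≤ ‖J p‖ ^ 2) :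
    ∃ L : E →L[ℂ] W, (∀ f q, ⟪J q, J (L f)⟫_ℂ = ⟪I q, f⟫_ℂ) ∧
      (∀ f p, (∀ q, ⟪J q, J p⟫_ℂ = ⟪I q, f⟫_ℂ) → p = L f) := by
  set D : W →L[ℂ] W := (ContinuousLinearMap.adjoint J).comp J with hD
  have hDin : ∀ p q, ⟪q, D p⟫_ℂ = ⟪J q, J p⟫_ℂ := fun p q =>
    ContinuousLinearMap.adjoint_inner_right J q (J p)
  have hu : IsUnit D := isUnit_of_re_inner_ge hc fun p => by
    have h1 : ⟪D p, p⟫_ℂ = ((‖J p‖ ^ 2 : ℝ) : ℂ) := by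
      rw [hD, ContinuousLinearMap.comp_apply, ContinuousLinearMap.adjoint_inner_left,
        inner_self_eq_norm_sq_to_K]
      norm_cast
    rw [h1, Complex.ofReal_re]
    exact (hJ p).trans (le_abs_self _)
  have hr : ∀ p, D (Ring.inverse D p) = p := fun p =>
    congrArg (fun D : W →L[ℂ] W => D p) (Ring.mul_inverse_cancel D hu)
  have hl : ∀ p, Ring.inverse D (D p) = p := fun p =>
    congrArg (fun D : W →L[ℂ] W => D p) (Ring.inverse_mul_cancel D hu)
  refine ⟨(Ring.inverse D).comp (ContinuousLinearMap.adjoint I), fun f q => ?_, fun f p h => ?_⟩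
  · have h1 : D (((Ring.inverse D).comp (ContinuousLinearMap.adjoint I)) f)
        = ContinuousLinearMap.adjoint I f := hr _
    rw [← hDin, h1, ContinuousLinearMap.adjoint_inner_right]
  · have : D p = ContinuousLinearMap.adjoint I f := ext_inner_left ℂ fun q => by
      rw [hDin, h, ContinuousLinearMap.adjoint_inner_right]
    rw [ContinuousLinearMap.comp_apply, ← this, hl]

variable (Ω) in
/-- The Hilbert space `L²(Ω) × L²(Ω)ⁿ` of values and gradients. -/
abbrev JetSpace : Type := WithLp 2 (L2 Ω × PiLp 2 fun _ : Fin n => L2 Ω)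

variable (Ω) in
/-- Forgetting the Hilbert norm. -/
def jetToProd : JetSpace Ω →L[ℂ] L2 Ω × (Fin n → L2 Ω) :=
  (WithLp.fstL 2 ℂ (L2 Ω) (PiLp 2 fun _ : Fin n => L2 Ω)).prod
    (((PiLp.continuousLinearEquiv 2 ℂ fun _ : Fin n => L2 Ω) :
      (PiLp 2 fun _ : Fin n => L2 Ω) →L[ℂ] (Fin n → L2 Ω)).comp
        (WithLp.sndL 2 ℂ (L2 Ω) (PiLp 2 fun _ : Fin n => L2 Ω)))

variable (Ω) in
/-- `H¹₀(Ω)` with its Hilbert norm. -/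
def hilbertH10 : Submodule ℂ (JetSpace Ω) :=
  (sobolevH10 Ω).comap (jetToProd Ω : JetSpace Ω →ₗ[ℂ] L2 Ω × (Fin n → L2 Ω))

instance : CompleteSpace (hilbertH10 Ω) := by
  have hWc : IsClosed (hilbertH10 Ω : Set (JetSpace Ω)) :=
    (Submodule.isClosed_topologicalClosure (testGradient Ω)).preimage (jetToProd Ω).continuous
  exact hWc.completeSpace_coe

variable (Ω) in
/-- The inclusion of `H¹₀(Ω)` in `L²(Ω)`. -/
def h10Val : hilbertH10 Ω →L[ℂ] L2 Ω :=
  (WithLp.fstL 2 ℂ (L2 Ω) (PiLp 2 fun _ : Fin n => L2 Ω)).comp (hilbertH10 Ω).subtypeL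

variable (Ω) in
/-- The gradient on `H¹₀(Ω)`. -/
def h10Grad : hilbertH10 Ω →L[ℂ] PiLp 2 fun _ : Fin n => L2 Ω :=
  (WithLp.sndL 2 ℂ (L2 Ω) (PiLp 2 fun _ : Fin n => L2 Ω)).comp (hilbertH10 Ω).subtypeL

theorem h10_mem (p : hilbertH10 Ω) : (h10Val Ω p, fun i => h10Grad Ω p i) ∈ sobolevH10 Ω := p.2

theorem exists_h10 {u : L2 Ω} {g : Fin n → L2 Ω} (h : (u, g) ∈ sobolevH10 Ω) :
    ∃ p : hilbertH10 Ω, h10Val Ω p = u ∧ ∀ i, h10Grad Ω p i = g i :=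
  ⟨⟨WithLp.toLp 2 (u, WithLp.toLp 2 g), h⟩, rfl, fun _ => rfl⟩

theorem norm_sq_h10 (p : hilbertH10 Ω) : ‖p‖ ^ 2 = ‖h10Val Ω p‖ ^ 2 + ‖h10Grad Ω p‖ ^ 2 :=
  WithLp.prod_norm_sq_eq_of_L2 (p : JetSpace Ω)

theorem inner_testGradient_extend {f : L2 Ω} {g : Fin n → L2 Ω}
    (h : ∀ q ∈ testGradient Ω, ∑ i, ⟪q.2 i, g i⟫_ℂ = ⟪q.1, f⟫_ℂ)
    {q : L2 Ω × (Fin n → L2 Ω)} (hq : q ∈ sobolevH10 Ω) :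
    ∑ i, ⟪q.2 i, g i⟫_ℂ = ⟪q.1, f⟫_ℂ := by
  have hcl : IsClosed {q : L2 Ω × (Fin n → L2 Ω) | ∑ i, ⟪q.2 i, g i⟫_ℂ = ⟪q.1, f⟫_ℂ} :=
    isClosed_eq (by fun_prop) (by fun_prop)
  exact closure_minimal h hcl hq

/-- The weak solution operator of the Dirichlet problem. -/
theorem exists_weak_solution (hn : 1 ≤ n)
    (hΩ : Bornology.IsBounded (Ω : Set (EuclideanSpace ℝ (Fin n)))) :
    ∃ L : L2 Ω →L[ℂ] hilbertH10 Ω,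
      (∀ f q, ⟪h10Grad Ω q, h10Grad Ω (L f)⟫_ℂ = ⟪h10Val Ω q, f⟫_ℂ) ∧
      (∀ f p, (∀ q, ⟪h10Grad Ω q, h10Grad Ω p⟫_ℂ = ⟪h10Val Ω q, f⟫_ℂ) → p = L f) := by
  obtain ⟨ρ, hρ, hρΩ⟩ := hΩ.exists_pos_norm_le
  have hP : ∀ p, ‖h10Val Ω p‖ ≤ 2 * ρ * ‖h10Grad Ω p‖ := fun p =>
    (norm_le_of_mem_sobolevH10 hρ.le hρΩ ⟨0, hn⟩ (h10_mem p)).trans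
      (mul_le_mul_of_nonneg_left (PiLp.norm_apply_le (h10Grad Ω p) ⟨0, hn⟩) (by positivity))
  have hJ : ∀ p, ((2 * ρ) ^ 2 + 1)⁻¹ * ‖p‖ ^ 2 ≤ ‖h10Grad Ω p‖ ^ 2 := fun p => by
    rw [inv_mul_le_iff₀ (by positivity), norm_sq_h10]
    have := pow_le_pow_left₀ (norm_nonneg _) (hP p) 2
    rw [mul_pow] at this
    linarith
  have key := exists_inner_comp_inverse (E := L2 Ω) (W := hilbertH10 Ω)
    (G := PiLp 2 fun _ : Fin n => L2 Ω) (h10Val Ω) (h10Grad Ω) (c := ((2 * ρ) ^ 2 + 1)⁻¹)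
    (by positivity) hJ
  exact key

theorem mem_dirichletLaplacianGraph_of_weak {p : hilbertH10 Ω} {f : L2 Ω}
    (h : ∀ q, ⟪h10Grad Ω q, h10Grad Ω p⟫_ℂ = ⟪h10Val Ω q, f⟫_ℂ) :
    (h10Val Ω p, f) ∈ dirichletLaplacianGraph Ω := by
  refine ⟨fun i => h10Grad Ω p i, h10_mem p, fun q hq => ?_⟩
  obtain ⟨r, hr1, hr2⟩ := exists_h10 (Submodule.le_topologicalClosure _ hq)
  have h1 := h r
  rw [PiLp.inner_apply, hr1] at h1
  rw [← h1]
  exact Finset.sum_congr rfl fun i _ => by rw [← hr2 i]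

theorem exists_weak_of_mem_dirichletLaplacianGraph {u f : L2 Ω}
    (h : (u, f) ∈ dirichletLaplacianGraph Ω) : ∃ p : hilbertH10 Ω, h10Val Ω p = u ∧
      ∀ q, ⟪h10Grad Ω q, h10Grad Ω p⟫_ℂ = ⟪h10Val Ω q, f⟫_ℂ := by
  obtain ⟨g, hg, hq⟩ := h
  obtain ⟨p, hp1, hp2⟩ := exists_h10 hg
  refine ⟨p, hp1, fun q => ?_⟩
  rw [PiLp.inner_apply, ← inner_testGradient_extend hq (h10_mem q)]
  exact Finset.sum_congr rfl fun i _ => by rw [← hp2 i]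

/-- Testing the weak equation with the pair `(0, g)` itself gives `‖g‖² = ⟪0, f⟫ = 0`, so
closability of the gradient need not be proved separately. Then `f` is orthogonal to all test
functions. -/
theorem eq_zero_of_mem_dirichletLaplacianGraph {f : L2 Ω}
    (h : ((0 : L2 Ω), f) ∈ dirichletLaplacianGraph Ω) : f = 0 := by
  obtain ⟨p, hp1, hp2⟩ := exists_weak_of_mem_dirichletLaplacianGraph h
  have h2 : h10Grad Ω p = 0 := by
    have h1 := hp2 p
    rwa [hp1, inner_zero_left, inner_self_eq_zero] at h1
  refine eq_zero_of_inner_testGradient fun q hq => ?_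
  obtain ⟨r, hr1, -⟩ := exists_h10 (Submodule.le_topologicalClosure _ hq)
  rw [← hr1, ← hp2, h2, inner_zero_right]

theorem mem_graph_dirichletLaplacian (u f : L2 Ω) :
    (u, f) ∈ (dirichletLaplacian Ω).graph ↔ (u, f) ∈ dirichletLaplacianGraph Ω := by
  rw [dirichletLaplacian, Submodule.toLinearPMap_graph_eq]
  rintro ⟨u, f⟩ hx (rfl : u = 0)
  exact eq_zero_of_mem_dirichletLaplacianGraph hx

theorem isBoundedInverse_of_graph {H : Type*} [NormedAddCommGroup H] [InnerProductSpace ℂ H]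
    {A : H →ₗ.[ℂ] H} {T : H →L[ℂ] H} (h : ∀ u f, (u, f) ∈ A.graph ↔ u = T f) :
    IsBoundedInverse A T := by
  refine ⟨fun f => ?_, fun u => ((h u _).1 (A.mem_graph u)).symm⟩
  obtain ⟨y, hy1, hy2⟩ := (LinearPMap.mem_graph_iff _).1 ((h (T f) f).2 rfl)
  have hy1' : (y : H) = T f := hy1
  refine ⟨hy1' ▸ y.2, ?_⟩
  have : (⟨T f, hy1' ▸ y.2⟩ : A.domain) = y := Subtype.ext hy1'.symm
  rw [this, hy2]

/-- On a bounded open set the Dirichlet Laplacian has a bounded positive injective inverse. -/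
theorem exists_isBoundedInverse_dirichletLaplacian (hn : 1 ≤ n)
    (hΩ : Bornology.IsBounded (Ω : Set (EuclideanSpace ℝ (Fin n)))) :
    ∃ T : L2 Ω →L[ℂ] L2 Ω, IsBoundedInverse (dirichletLaplacian Ω) T ∧ 0 ≤ T ∧
      Function.Injective T := by
  obtain ⟨L, hL, hLu⟩ := exists_weak_solution hn hΩ
  have hgraph : ∀ u f : L2 Ω, (u, f) ∈ (dirichletLaplacian Ω).graph ↔
      u = ((h10Val Ω).comp L) f := by
    intro u f
    rw [mem_graph_dirichletLaplacian, ContinuousLinearMap.comp_apply]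
    constructor
    · intro h
      obtain ⟨p, hp1, hp2⟩ := exists_weak_of_mem_dirichletLaplacianGraph h
      rw [← hp1, hLu f p hp2]
    · rintro rfl
      exact mem_dirichletLaplacianGraph_of_weak (hL f)
  refine ⟨(h10Val Ω).comp L, isBoundedInverse_of_graph hgraph, ?_, ?_⟩
  · rw [ContinuousLinearMap.nonneg_iff_isPositive, ContinuousLinearMap.isPositive_iff_complex]
    intro f
    -- The solution is used as its own test function: `⟪Tf, f⟫` is the Dirichlet energy of `Tf`.
    have h1 : ⟪((h10Val Ω).comp L) f, f⟫_ℂ = ((‖h10Grad Ω (L f)‖ ^ 2 : ℝ) : ℂ) := by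
      rw [ContinuousLinearMap.comp_apply, ← hL, inner_self_eq_norm_sq_to_K]
      norm_cast
    rw [h1, RCLike.re_eq_complex_re, Complex.ofReal_re]
    exact ⟨rfl, sq_nonneg _⟩
  · refine (injective_iff_map_eq_zero ((h10Val Ω).comp L)).2 fun f hf => ?_
    refine eq_zero_of_mem_dirichletLaplacianGraph ?_
    rw [← mem_graph_dirichletLaplacian, hgraph, hf]

end DirichletForm

/-! ### Generation of the analytic semigroup. -/

section AnalyticGeneration

variable {H : Type*} [NormedAddCommGroup H] [InnerProductSpace ℂ H] [CompleteSpace H]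

/-- The coupled system generates an analytic semigroup for every `A` with a bounded positive
injective inverse. -/
theorem generator_analytic (c : Coefficients) {A : H →ₗ.[ℂ] H} {T : H →L[ℂ] H}
    (hA : IsBoundedInverse A T) (hT : 0 ≤ T) (hinj : Function.Injective T) :
    (∀ l : ℝ, (l : ℂ) * Complex.I ∈ resolventSetPMap (generator c (1 / 2) 1 A)) ∧
    (∃ C : ℝ, 0 < C ∧ ∀ (l : ℝ) (F : PhaseSpace c 1 A) (U : (generator c (1 / 2) 1 A).domain),
      ((l : ℂ) * Complex.I) • (U : PhaseSpace c 1 A) - generator c (1 / 2) 1 A U = F →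
        |l| * ‖(U : PhaseSpace c 1 A)‖ ^ 2 ≤ C * ‖F‖ * ‖(U : PhaseSpace c 1 A)‖) ∧
    ∃ S : NNReal → PhaseSpace c 1 A →L[ℂ] PhaseSpace c 1 A,
      IsC0SemigroupGeneratedBy (generator c (1 / 2) 1 A) S ∧ IsAnalyticSemigroup S := by
  -- A fourth root of `A⁻¹` is taken because the generator is `A^{1/2}M = R⁻²M`, and the Lyapunov
  -- estimates distribute one `R` to each side of the inner product.
  set R : H →L[ℂ] H := CFC.sqrt (CFC.sqrt T) with hRdef
  have hRR : R * R = CFC.sqrt T := CFC.sqrt_mul_sqrt_self _ (CFC.sqrt_nonneg T)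
  have hRT : R * R * (R * R) = T := by rw [hRR, CFC.sqrt_mul_sqrt_self T hT]
  have hR : IsSelfAdjoint R := (CFC.sqrt_nonneg (CFC.sqrt T)).isSelfAdjoint
  have hRinj : Function.Injective R := fun x y hxy => hinj (by
    rw [← hRT]
    change R (R (R (R x))) = R (R (R (R y)))
    rw [hxy])
  have hpow : negPow A (1 / 2) = R * R := by
    rw [negPow, boundedInverse_eq hA, hRR, CFC.sqrt_eq_rpow]
  have hA' : IsBoundedInverse A (R * R * (R * R)) := hRT.symm ▸ hA
  have hF : IsBoundedInverse (fracPow A (1 / 2)) (R * R) :=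
    isBoundedInverse_fracPow hpow (hRinj.comp hRinj)
  obtain ⟨P, d, hP⟩ := exists_isLyapunovTriple c hR hRinj
  have hB := generator_graph_iff (c := c) hR hRinj hpow hA' hF
  exact ⟨fun l => mem_resolventSetPMap_of_graph hP hB (by simp), exists_norm_sq_le_of_graph hP hB,
    _, isC0Semigroup_of_graph hP hB, isAnalyticSemigroup_conjOp hP⟩

end AnalyticGeneration

end

theorem mainTheorem4 (n : ℕ) (hn : 1 ≤ n)
    (Ω : TopologicalSpace.Opens (EuclideanSpace ℝ (Fin n)))
    (hΩ : Bornology.IsBounded (Ω : Set (EuclideanSpace ℝ (Fin n))))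
    (c : Coefficients) :
    (∀ l : ℝ, (l : ℂ) * Complex.I ∈
      resolventSetPMap (generator c (1 / 2) 1 (dirichletLaplacian Ω))) ∧
    (∃ C : ℝ, 0 < C ∧ ∀ (l : ℝ) (F : PhaseSpace c 1 (dirichletLaplacian Ω))
      (U : (generator c (1 / 2) 1 (dirichletLaplacian Ω)).domain),
      ((l : ℂ) * Complex.I) • (U : PhaseSpace c 1 (dirichletLaplacian Ω))
          - generator c (1 / 2) 1 (dirichletLaplacian Ω) U = F →
        |l| * ‖(U : PhaseSpace c 1 (dirichletLaplacian Ω))‖ ^ 2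
          ≤ C * ‖F‖ * ‖(U : PhaseSpace c 1 (dirichletLaplacian Ω))‖) ∧
    ∃ S : NNReal → PhaseSpace c 1 (dirichletLaplacian Ω) →L[ℂ]
        PhaseSpace c 1 (dirichletLaplacian Ω),
      IsC0SemigroupGeneratedBy (generator c (1 / 2) 1 (dirichletLaplacian Ω)) S ∧
      IsAnalyticSemigroup S := by
  obtain ⟨T, hA, hT, hinj⟩ := exists_isBoundedInverse_dirichletLaplacian hn hΩ
  exact generator_analytic c hA hT hinj
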